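/- Let $n\in\mathbb N$ and identify $\mathbb T^n$ with $[0,1)^n$ (Lebesgue measure). For $\varphi\in L^2(\mathbb R^{2n})$ and $k,l\in\mathbb Z^n$ let $T^t_{(k,l)}\varphi(x,y)=e^{\pi i(x\cdot l-y\cdot k)}\varphi(x-k,y-l)$ be the twisted translation. Let $$K_\varphi(\xi,\eta)=\int_{\mathbb R^n}\varphi(x,\eta-\xi)\,e^{\pi i x\cdot(\xi+\eta)}\,dx\qquad(\varphi\in L^1\cap L^2(\mathbb R^{2n}))$$ be the kernel of the Weyl transform of $\varphi$, and let $\varphi\mapsto K_\varphi$ also denote its continuous (isometric) extension to $L^2(\mathbb R^{2n})$. The Weyl–Zak transform is $Z_W\varphi(\xi,\xi',\eta)=\sum_{m\in\mathbb Z^n}K_\varphi(m+\xi,\eta)e^{-2\pi i m\cdot\xi'}$, with convergence in $L^2(\mathbb T^n\times\mathbb T^n\times\mathbb R^n)$, and for a.e. $(\xi,\xi')\in\mathbb T^n\times\mathbb T^n$ we put $\mathcal J\varphi(\xi,\xi')=Z_W\varphi(\xi,\xi',\cdot)\in L^2(\mathbb R^n)$. Let $V\subset L^2(\mathbb R^{2n})$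 be a twisted shift-invariant space, that is, a closed subspace with $T^t_{(k,l)}V\subset V$ for all $k,l\in\mathbb Z^n$, and let $J$ be its range function: $J(\xi,\xi')=\overline{\operatorname{span}}\{\mathcal J f_i(\xi,\xi'):i\in\mathbb N\}$ for a.e. $(\xi,\xi')$, where $(f_i)$ is a dense sequence in $V$ (up to null sets $J$ does not depend on its choice). Let $P(\xi,\xi')$ be the orthogonal projection of $L^2(\mathbb R^n)$ onto $J(\xi,\xi')$. Let $U:V\to L^2(\mathbb R^{2n})$ be a twisted shift preserving operator, that is, a bounded linear operator with $UT^t_{(k,l)}f=T^t_{(k,l)}Uf$ for all $f\in V$ and $k,l\in\mathbb Z^n$. Let $R$ be the range operator corresponding to $U$: a family of bounded linear operators $R(\xi,\xi'):J(\xi,\xi')\to L^2(\mathbb R^n)$ such that $(\xi,\xi')\mapsto\langle R(\xi,\xi')P(\xi,\xi')a,b\rangle$ is measurable for all $a,b\in L^2(\mathbb R^n)$ and, for every $f\in V$, $$\mathcal J(Uf)(\xi,\xi')=R(\xi,\xi')\big(\mathcal Jf(\xi,\xi')\big)\quad\text{for a.e. }(\xi,\xi')\in\mathbb T^n\times\mathbb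 T^n.$$ Then, for every $c>0$, $U$ is bounded below with constant $c$, i.e. $\|Uf\|\ge c\|f\|$ for all $f\in V$, if and only if for a.e. $(\xi,\xi')\in\mathbb T^n\times\mathbb T^n$ the operator $R(\xi,\xi')$ is bounded below with constant $c$, i.e. $\|R(\xi,\xi')a\|\ge c\|a\|$ for all $a\in J(\xi,\xi')$. -/

import Mathlib

open MeasureTheory

noncomputable section

namespace TwistedShift

/-- The Euclidean space `ℝⁿ`. -/
abbrev E (n : ℕ) : Type := EuclideanSpace ℝ (Fin n)

/-- The Hilbert space `L²(ℝⁿ)`. -/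
abbrev L2Space (n : ℕ) : Type := Lp ℂ 2 (volume : Measure (E n))

/-- The Hilbert space `L²(ℝ²ⁿ)`, where `ℝ²ⁿ = ℝⁿ × ℝⁿ`. -/
abbrev L2Phase (n : ℕ) : Type := Lp ℂ 2 (volume : Measure (E n × E n))

/-- A lattice point `k ∈ ℤⁿ` as a vector of `ℝⁿ`. -/
def latticePt {n : ℕ} (k : Fin n → ℤ) : E n := WithLp.toLp 2 fun i => (k i : ℝ)

/-! ### Twisted translations -/

/-- `e^{πi (x·l - y·k)} φ(x - k, y - l)`. -/
def twistedTranslateFun {n : ℕ} (k l : Fin n → ℤ) (φ : E n × E n → ℂ) (p : E n × E n) : ℂ :=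
  Complex.exp (Real.pi * Complex.I *
      ((inner ℝ p.1 (latticePt l) - inner ℝ p.2 (latticePt k) : ℝ) : ℂ)) *
    φ (p.1 - latticePt k, p.2 - latticePt l)

theorem norm_exp_pi_I (r : ℝ) : ‖Complex.exp (Real.pi * Complex.I * (r : ℂ))‖ = 1 := by
  have : (Real.pi * Complex.I * (r : ℂ)) = ((Real.pi * r : ℝ) : ℂ) * Complex.I := by
    push_cast; ring
  rw [this, Complex.norm_exp_ofReal_mul_I]

theorem memLp_twistedTranslateFun {n : ℕ} (k l : Fin n → ℤ) {φ : E n × E n → ℂ}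
    (hφ : MemLp φ 2 volume) : MemLp (twistedTranslateFun k l φ) 2 volume := by
  have hmp : MeasurePreserving (fun p : E n × E n => p - (latticePt k, latticePt l))
      volume volume :=
    (measurePreserving_sub_right volume (latticePt k)).prod
      (measurePreserving_sub_right volume (latticePt l))
  have h1 : MemLp (fun p : E n × E n => φ (p.1 - latticePt k, p.2 - latticePt l)) 2 volume :=
    hφ.comp_measurePreserving hmp
  have hc : Continuous fun p : E n × E n => Complex.exp (Real.pi * Complex.I *
      ((inner ℝ p.1 (latticePt l) - inner ℝ p.2 (latticePt k) : ℝ) : ℂ)) := by fun_prop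
  refine h1.of_le (hc.aestronglyMeasurable.mul h1.aestronglyMeasurable) ?_
  refine Filter.Eventually.of_forall fun p => ?_
  simp only [twistedTranslateFun, norm_mul, norm_exp_pi_I, one_mul]
  exact le_rfl

/-- The twisted translation `T^t_{(k,l)}` on `L²(ℝ²ⁿ)`. -/
def twistedTranslate {n : ℕ} (k l : Fin n → ℤ) (φ : L2Phase n) : L2Phase n :=
  (memLp_twistedTranslateFun k l (Lp.memLp φ)).toLp _

/-! ### The kernel of the Weyl transform -/

/-- The kernel `K_g(ξ, η) = ∫ g(x, η - ξ) e^{πi x·(ξ + η)} dx` of the Weyl transform of `g`. -/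
def weylKernelFun {n : ℕ} (g : E n × E n → ℂ) (p : E n × E n) : ℂ :=
  ∫ x : E n, g (x, p.2 - p.1) *
    Complex.exp (Real.pi * Complex.I * ((inner ℝ x (p.1 + p.2) : ℝ) : ℂ))

theorem eLpNorm_two_sq {α : Type*} [MeasurableSpace α] (μ : Measure α) (F : α → ℂ) :
    eLpNorm F 2 μ ^ 2 = ∫⁻ v, ‖F v‖ₑ ^ 2 ∂μ := by
  have := eLpNorm_nnreal_pow_eq_lintegral (μ := μ) (f := F) (p := 2) (by norm_num)
  simpa using this

section Plancherel

open FourierTransform SchwartzMap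

theorem continuous_fourierInv {n : ℕ} {f : E n → ℂ} (h1 : Integrable f) :
    Continuous (𝓕⁻ f) :=
  VectorFourier.fourierIntegral_continuous Real.continuous_fourierChar
    (L := -innerₗ (E n)) (by simp only [LinearMap.neg_apply, innerₗ_apply_apply]; fun_prop) h1

theorem fourierInv_ae_eq {n : ℕ} (f : E n → ℂ) (h1 : Integrable f) (h2 : MemLp f 2 volume) :
    (𝓕⁻ (h2.toLp f) : L2Space n) =ᵐ[volume] 𝓕⁻ f := by
  refine ae_eq_of_integral_contDiff_smul_eq
    ((Lp.memLp _).locallyIntegrable (by norm_num)) (continuous_fourierInv h1).locallyIntegrable ?_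
  intro g g_smooth g_cpt
  have hg₁ : HasCompactSupport (Complex.ofRealCLM ∘ g) := g_cpt.comp_left rfl
  have hg₂ : ContDiff ℝ (⊤ : ℕ∞) (Complex.ofRealCLM ∘ g) := by fun_prop
  set G : 𝓢(E n, ℂ) := hg₁.toSchwartzMap hg₂ with hG
  have key : ∫ x, G x • (𝓕⁻ (h2.toLp f) : L2Space n) x = ∫ x, 𝓕⁻ G x • (h2.toLp f) x := by
    rw [← Lp.toTemperedDistribution_apply, ← Lp.fourierInv_toTemperedDistribution_eq,
      TemperedDistribution.fourierInv_apply, Lp.toTemperedDistribution_apply]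
  have h3 : ∫ x, 𝓕⁻ G x • (h2.toLp f) x = ∫ x, 𝓕⁻ (G : E n → ℂ) x • f x := by
    refine integral_congr_ae ?_
    filter_upwards [h2.coeFn_toLp] with x hx
    rw [hx, fourierInv_coe]
  have h4 : ∫ x, 𝓕⁻ (G : E n → ℂ) x • f x = ∫ x, G x • 𝓕⁻ f x := by
    have := VectorFourier.integral_fourierIntegral_smul_eq_flip (μ := volume) (ν := volume)
      (L := -innerₗ (E n)) Real.continuous_fourierChar
      (by simp only [LinearMap.neg_apply, innerₗ_apply_apply]; fun_prop) G.integrable h1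
    have hflip : (-innerₗ (E n)).flip = -innerₗ (E n) := by
      ext x y; simp [real_inner_comm]
    rw [hflip] at this
    exact this
  have h5 := key.trans (h3.trans h4)
  simpa [hG] using h5

theorem lintegral_fourierInv {n : ℕ} (f : E n → ℂ) (h1 : Integrable f) (h2 : MemLp f 2 volume) :
    ∫⁻ v, ‖𝓕⁻ f v‖ₑ ^ 2 = ∫⁻ x, ‖f x‖ₑ ^ 2 := by
  have h := ((Lp.fourierTransformₗᵢ (E n) ℂ).symm).norm_map (h2.toLp f)
  change ‖(𝓕⁻ (h2.toLp f) : L2Space n)‖ = _ at h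
  have h' : eLpNorm (𝓕⁻ f) 2 volume = eLpNorm f 2 volume := by
    rw [← eLpNorm_congr_ae (fourierInv_ae_eq f h1 h2), ← eLpNorm_congr_ae h2.coeFn_toLp]
    rw [Lp.norm_def, Lp.norm_def] at h
    exact (ENNReal.toReal_eq_toReal_iff' (Lp.eLpNorm_ne_top _) (Lp.eLpNorm_ne_top _)).1 h
  rw [← eLpNorm_two_sq, ← eLpNorm_two_sq, h']

end Plancherel

theorem weylKernelFun_eq {n : ℕ} (g : E n × E n → ℂ) (ξ u : E n) :
    weylKernelFun g (ξ, ξ + u) =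
      FourierTransform.fourierInv (fun x => g (x, u)) (ξ + (1 / 2 : ℝ) • u) := by
  rw [weylKernelFun, Real.fourierInv_eq']
  congr 1
  ext x
  simp only [add_sub_cancel_left, smul_eq_mul]
  rw [mul_comm]
  congr 2
  simp only [inner_add_right, inner_smul_right]
  push_cast
  ring

theorem quasiMeasurePreserving_diff (n : ℕ) :
    Measure.QuasiMeasurePreserving (fun p : E n × E n => p.2 - p.1) volume volume :=
  (quasiMeasurePreserving_sub_of_right_invariant (volume : Measure (E n)) volume).comp
    Measure.measurePreserving_swap.quasiMeasurePreserving

theorem aestronglyMeasurable_weylKernelFun {n : ℕ} {g : E n × E n → ℂ}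
    (hg : AEStronglyMeasurable g volume) : AEStronglyMeasurable (weylKernelFun g) volume := by
  have hq : Measure.QuasiMeasurePreserving
      (fun q : (E n × E n) × E n => (q.2, q.1.2 - q.1.1)) (volume.prod volume) volume :=
    Measure.measurePreserving_swap.quasiMeasurePreserving.comp
      (MeasureTheory.QuasiMeasurePreserving.prodMap (quasiMeasurePreserving_diff n)
        (Measure.QuasiMeasurePreserving.id volume))
  have hc : Continuous fun q : (E n × E n) × E n =>
      Complex.exp (Real.pi * Complex.I * ((inner ℝ q.2 (q.1.1 + q.1.2) : ℝ) : ℂ)) := by fun_prop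
  exact ((hg.comp_quasiMeasurePreserving hq).mul hc.aestronglyMeasurable).integral_prod_right'

/-- Plancherel formula for the Weyl transform. -/
theorem lintegral_weylKernelFun {n : ℕ} {g : E n × E n → ℂ} (h1 : Integrable g volume)
    (h2 : MemLp g 2 volume) :
    ∫⁻ p, ‖weylKernelFun g p‖ₑ ^ 2 = ∫⁻ p, ‖g p‖ₑ ^ 2 := by
  have hm := aestronglyMeasurable_weylKernelFun h1.aestronglyMeasurable
  have hshear : MeasurePreserving (fun z : E n × E n => (z.1, z.1 + z.2))
      (volume.prod volume) (volume.prod volume) :=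
    measurePreserving_prod_add (volume : Measure (E n)) volume
  have hshear_emb : MeasurableEmbedding (fun z : E n × E n => (z.1, z.1 + z.2)) :=
    (MeasurableEquiv.shearAddRight (E n)).measurableEmbedding
  have hm2 : AEMeasurable (fun p => ‖weylKernelFun g p‖ₑ ^ 2)
      ((volume : Measure (E n)).prod volume) := hm.enorm.pow_const 2
  have hg2 : AEMeasurable (fun p => ‖g p‖ₑ ^ 2)
      ((volume : Measure (E n)).prod volume) := h1.aestronglyMeasurable.enorm.pow_const 2
  have hint : ∀ᵐ u : E n, Integrable (fun x => g (x, u)) volume := by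
    have h : Integrable g ((volume : Measure (E n)).prod volume) := h1
    exact h.prod_left_ae
  have hsq : ∀ᵐ u : E n, MemLp (fun x => g (x, u)) 2 volume := by
    have h : Integrable (fun p => ‖g p‖ ^ 2) ((volume : Measure (E n)).prod volume) :=
      h2.integrable_norm_pow (by norm_num)
    filter_upwards [h.prod_left_ae, hint] with u hu hu'
    refine (memLp_two_iff_integrable_sq_norm hu'.aestronglyMeasurable).2 hu
  rw [Measure.volume_eq_prod, ← hshear.lintegral_comp_emb hshear_emb,
    lintegral_prod_symm (fun z : E n × E n => ‖weylKernelFun g (z.1, z.1 + z.2)‖ₑ ^ 2)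
      (hm2.comp_quasiMeasurePreserving hshear.quasiMeasurePreserving),
    lintegral_prod_symm _ hg2]
  refine lintegral_congr_ae ?_
  filter_upwards [hint, hsq] with u hu1 hu2
  simp only [weylKernelFun_eq]
  rw [lintegral_add_right_eq_self (μ := (volume : Measure (E n)))
    (fun ξ => ‖FourierTransform.fourierInv (fun x => g (x, u)) ξ‖ₑ ^ 2)]
  exact lintegral_fourierInv _ hu1 hu2

theorem eLpNorm_weylKernelFun {n : ℕ} {g : E n × E n → ℂ} (h1 : Integrable g volume)
    (h2 : MemLp g 2 volume) : eLpNorm (weylKernelFun g) 2 volume = eLpNorm g 2 volume := by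
  have h := lintegral_weylKernelFun h1 h2
  rw [← eLpNorm_two_sq, ← eLpNorm_two_sq] at h
  exact (ENNReal.pow_right_strictMono two_ne_zero).injective h

theorem memLp_weylKernelFun {n : ℕ} {g : E n × E n → ℂ} (h1 : Integrable g volume)
    (h2 : MemLp g 2 volume) : MemLp (weylKernelFun g) 2 volume :=
  ⟨aestronglyMeasurable_weylKernelFun h1.aestronglyMeasurable,
    (eLpNorm_weylKernelFun h1 h2).trans_lt h2.2⟩

/-- The dense subspace `L¹ ∩ L²` of `L²(ℝ²ⁿ)`. -/
def integrableSubspace (n : ℕ) : Submodule ℂ (L2Phase n) where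
  carrier := {f | Integrable f volume}
  zero_mem' := (integrable_zero _ ℂ volume).congr (Lp.coeFn_zero ℂ 2 volume).symm
  add_mem' := fun {f g} hf hg => (hf.add hg).congr (Lp.coeFn_add f g).symm
  smul_mem' := fun c f hf => (hf.smul c).congr (Lp.coeFn_smul c f).symm

theorem ae_slice {n : ℕ} {P : E n × E n → Prop} (h : ∀ᵐ p : E n × E n, P p) :
    ∀ᵐ p : E n × E n, ∀ᵐ x : E n, P (x, p.2 - p.1) := by
  have h' : ∀ᵐ q ∂((volume : Measure (E n)).prod volume), P q.swap :=
    Measure.measurePreserving_swap.quasiMeasurePreserving.ae h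
  exact (quasiMeasurePreserving_diff n).ae (Measure.ae_ae_of_ae_prod h')

theorem ae_slice_integrable {n : ℕ} {g : E n × E n → ℂ} (h : Integrable g volume) :
    ∀ᵐ p : E n × E n, Integrable (fun x => g (x, p.2 - p.1) *
      Complex.exp (Real.pi * Complex.I * ((inner ℝ x (p.1 + p.2) : ℝ) : ℂ))) volume := by
  have h' : Integrable g ((volume : Measure (E n)).prod volume) := h
  filter_upwards [(quasiMeasurePreserving_diff n).ae h'.prod_left_ae] with p hp
  refine hp.mul_bdd (c := 1) ?_ (Filter.Eventually.of_forall fun x => (norm_exp_pi_I _).le)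
  exact Continuous.aestronglyMeasurable (by fun_prop)

/-- The map `g ↦ K_g` on `L¹ ∩ L²`. -/
def weylKernelAux (n : ℕ) : integrableSubspace n →ₗ[ℂ] L2Phase n where
  toFun g := (memLp_weylKernelFun g.2 (Lp.memLp g.1)).toLp _
  map_add' f g := by
    rw [← MemLp.toLp_add]
    refine MemLp.toLp_congr _ _ ?_
    filter_upwards [ae_slice (Lp.coeFn_add f.1 g.1), ae_slice_integrable f.2,
      ae_slice_integrable g.2] with p hp hf hg
    simp only [Pi.add_apply, weylKernelFun]
    rw [← integral_add hf hg]
    refine integral_congr_ae ?_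
    filter_upwards [hp] with x hx
    simp only [Submodule.coe_add, hx, Pi.add_apply, add_mul]
  map_smul' c f := by
    rw [RingHom.id_apply, ← MemLp.toLp_const_smul]
    refine MemLp.toLp_congr _ _ ?_
    filter_upwards [ae_slice (Lp.coeFn_smul c f.1)] with p hp
    simp only [Pi.smul_apply, weylKernelFun]
    rw [← integral_smul]
    refine integral_congr_ae ?_
    filter_upwards [hp] with x hx
    simp only [Submodule.coe_smul, hx, Pi.smul_apply, smul_eq_mul, mul_assoc]

/-- The kernel map `φ ↦ K_φ` of the Weyl transform on all of `L²(ℝ²ⁿ)`: the continuous extension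
of its integral formula from `L¹ ∩ L²`. -/
def weylKernel (n : ℕ) : L2Phase n →L[ℂ] L2Phase n :=
  (weylKernelAux n).extendOfNorm (integrableSubspace n).subtype

theorem norm_weylKernelAux {n : ℕ} (g : integrableSubspace n) : ‖weylKernelAux n g‖ = ‖g‖ := by
  change ‖(memLp_weylKernelFun g.2 (Lp.memLp g.1)).toLp _‖ = ‖g.1‖
  rw [Lp.norm_toLp, eLpNorm_weylKernelFun g.2 (Lp.memLp g.1), Lp.norm_def]

theorem denseRange_integrableSubspace (n : ℕ) : DenseRange (integrableSubspace n).subtype := by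
  refine (Lp.simpleFunc.denseRange (E := ℂ) (μ := (volume : Measure (E n × E n)))
    (p := 2) (by norm_num)).mono ?_
  rintro _ ⟨f, rfl⟩
  refine ⟨⟨f.1, ?_⟩, rfl⟩
  have h := Lp.simpleFunc.toSimpleFunc_eq_toFun f
  refine Integrable.congr ?_ h
  exact (SimpleFunc.integrable_iff.2 ((SimpleFunc.memLp_iff (by norm_num) (by norm_num)).1
    (Lp.simpleFunc.memLp f)))

/-- On `L¹ ∩ L²`, the kernel is given by its integral formula. -/
theorem weylKernel_coeFn {n : ℕ} (g : L2Phase n) (hg : Integrable g volume) :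
    weylKernel n g =ᵐ[volume] weylKernelFun g := by
  have h := LinearMap.extendOfNorm_eq (f := weylKernelAux n) (denseRange_integrableSubspace n)
    ⟨1, fun x => by rw [norm_weylKernelAux, one_mul]; rfl⟩ ⟨g, hg⟩
  change weylKernel n g = (memLp_weylKernelFun hg (Lp.memLp g)).toLp _ at h
  rw [h]
  exact MemLp.coeFn_toLp _

/-- The Plancherel formula: the kernel map is isometric on `L²(ℝ²ⁿ)`. -/
theorem norm_weylKernel {n : ℕ} (g : L2Phase n) : ‖weylKernel n g‖ = ‖g‖ := by
  refine (denseRange_integrableSubspace n).induction_on (p := fun g => ‖weylKernel n g‖ = ‖g‖) g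
    (isClosed_eq (by fun_prop) (by fun_prop)) fun f => ?_
  have h := LinearMap.extendOfNorm_eq (f := weylKernelAux n) (denseRange_integrableSubspace n)
    ⟨1, fun x => by rw [norm_weylKernelAux, one_mul]; rfl⟩ f
  change weylKernel n _ = _ at h
  rw [h, norm_weylKernelAux]
  rfl

/-! ### The Weyl-Zak transform and the map `𝒥` -/

/-- The unit cube `[0, 1)ⁿ`, a set of representatives of the torus `𝕋ⁿ`. -/
def unitCube (n : ℕ) : Set (E n) := {ξ | ∀ i, ξ i ∈ Set.Ico (0 : ℝ) 1}

/-- The measure of the torus `𝕋ⁿ`: Lebesgue measure on `[0, 1)ⁿ`. -/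
def torusMeasure (n : ℕ) : Measure (E n) := volume.restrict (unitCube n)

/-- The product measure on `𝕋ⁿ × 𝕋ⁿ`. -/
def torusSq (n : ℕ) : Measure (E n × E n) := (torusMeasure n).prod (torusMeasure n)

instance instIsProbabilityMeasureTorus (n : ℕ) : IsProbabilityMeasure (torusMeasure n) := by
  refine ⟨?_⟩
  have h : unitCube n = (WithLp.ofLp : E n → Fin n → ℝ) ⁻¹'
      (Set.univ.pi fun _ => Set.Ico (0 : ℝ) 1) := by
    ext ξ; simp [unitCube]
  rw [torusMeasure, Measure.restrict_apply_univ, h,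
    (PiLp.volume_preserving_ofLp (Fin n)).measure_preimage
      (MeasurableSet.univ_pi fun _ => measurableSet_Ico).nullMeasurableSet, volume_pi,
    Measure.pi_pi]
  simp

instance instIsProbabilityMeasureTorusSq (n : ℕ) : IsProbabilityMeasure (torusSq n) := by
  unfold torusSq; infer_instance

/-- The Hilbert space `L²(𝕋ⁿ × 𝕋ⁿ × ℝⁿ)`. -/
abbrev L2Zak (n : ℕ) : Type := Lp ℂ 2 ((torusSq n).prod (volume : Measure (E n)))

/-- The term `K(m + ξ, η) e^{-2πi m·ξ'}` of the Zak series, at the point `((ξ, ξ'), η)`. -/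
def zakTermFun {n : ℕ} (m : Fin n → ℤ) (K : E n × E n → ℂ) (q : (E n × E n) × E n) : ℂ :=
  K (latticePt m + q.1.1, q.2) *
    Complex.exp (-(2 * Real.pi * Complex.I * ((inner ℝ (latticePt m) q.1.2 : ℝ) : ℂ)))

theorem memLp_zakTermFun {n : ℕ} (m : Fin n → ℤ) {K : E n × E n → ℂ} (hK : MemLp K 2 volume) :
    MemLp (zakTermFun m K) 2 ((torusSq n).prod volume) := by
  have h1 : MemLp (fun p : E n × E n => K (latticePt m + p.1, p.2)) 2 volume :=
    hK.comp_measurePreserving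
      ((measurePreserving_add_left (volume : Measure (E n)) (latticePt m)).prod
        (MeasurePreserving.id (volume : Measure (E n))))
  have h2 : MemLp (fun p : E n × E n => K (latticePt m + p.1, p.2)) 2
      ((torusMeasure n).prod volume) :=
    h1.mono_measure (Measure.prod_mono Measure.restrict_le_self le_rfl)
  have h3 : MemLp (fun q : (E n × E n) × E n => K (latticePt m + q.1.1, q.2)) 2
      ((torusSq n).prod volume) :=
    h2.comp_measurePreserving
      ((measurePreserving_fst (μ := torusMeasure n) (ν := torusMeasure n)).prod
        (MeasurePreserving.id (volume : Measure (E n))))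
  have hc : Continuous fun q : (E n × E n) × E n => Complex.exp
      (-(2 * Real.pi * Complex.I * ((inner ℝ (latticePt m) q.1.2 : ℝ) : ℂ))) := by fun_prop
  refine h3.of_le (h3.aestronglyMeasurable.mul hc.aestronglyMeasurable) ?_
  refine Filter.Eventually.of_forall fun q => ?_
  have e : (-(2 * Real.pi * Complex.I * ((inner ℝ (latticePt m) q.1.2 : ℝ) : ℂ)))
      = Real.pi * Complex.I * ((-2 * inner ℝ (latticePt m) q.1.2 : ℝ) : ℂ) := by
    push_cast; ring
  rw [zakTermFun, norm_mul, e, norm_exp_pi_I, mul_one]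

/-- The `m`-th term of the Zak series of `K`, as an element of `L²(𝕋ⁿ × 𝕋ⁿ × ℝⁿ)`. -/
def zakTerm {n : ℕ} (m : Fin n → ℤ) (K : L2Phase n) : L2Zak n :=
  (memLp_zakTermFun m (Lp.memLp K)).toLp _

/-- The characters `e^{2πi k·ξ}`, `k ≠ 0`, have mean zero on the torus. -/
theorem integral_character {n : ℕ} {k : Fin n → ℤ} (hk : k ≠ 0) :
    ∫ ξ, Complex.exp (2 * Real.pi * Complex.I * ((inner ℝ (latticePt k) ξ : ℝ) : ℂ))
      ∂torusMeasure n = 0 := by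
  have h : unitCube n = (WithLp.ofLp : E n → Fin n → ℝ) ⁻¹'
      (Set.univ.pi fun _ => Set.Ico (0 : ℝ) 1) := by
    ext ξ; simp [unitCube]
  have hmp : MeasurePreserving (WithLp.ofLp : E n → Fin n → ℝ) (torusMeasure n)
      (Measure.pi fun _ : Fin n => (volume : Measure ℝ).restrict (Set.Ico 0 1)) := by
    rw [torusMeasure, h, ← Measure.restrict_pi_pi]
    exact (PiLp.volume_preserving_ofLp (Fin n)).restrict_preimage
      (MeasurableSet.univ_pi fun _ => measurableSet_Ico)
  have hemb : MeasurableEmbedding (WithLp.ofLp : E n → Fin n → ℝ) :=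
    (MeasurableEquiv.toLp 2 (Fin n → ℝ)).symm.measurableEmbedding
  have hprod : ∀ ξ : E n,
      Complex.exp (2 * Real.pi * Complex.I * ((inner ℝ (latticePt k) ξ : ℝ) : ℂ)) =
        ∏ i, Complex.exp (2 * Real.pi * Complex.I * (k i) * ((WithLp.ofLp ξ i : ℝ) : ℂ)) := by
    intro ξ
    rw [← Complex.exp_sum, PiLp.inner_apply]
    congr 1
    push_cast
    rw [Finset.mul_sum]
    refine Finset.sum_congr rfl fun i _ => ?_
    simp [latticePt]
    ring
  simp only [hprod]
  rw [hmp.integral_comp hemb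
    (fun x : Fin n → ℝ => ∏ i, Complex.exp (2 * Real.pi * Complex.I * (k i) * (x i : ℂ))),
    integral_fintype_prod_eq_prod (𝕜 := ℂ)
      (fun i (t : ℝ) => Complex.exp (2 * Real.pi * Complex.I * (k i) * (t : ℂ)))]
  obtain ⟨i, hi⟩ := Function.ne_iff.1 hk
  refine Finset.prod_eq_zero (Finset.mem_univ i) ?_
  have hi' : ((k i : ℤ) : ℂ) ≠ 0 := by exact_mod_cast hi
  rw [integral_Ico_eq_integral_Ioc, ← intervalIntegral.integral_of_le zero_le_one,
    integral_exp_mul_complex (mul_ne_zero Complex.two_pi_I_ne_zero hi')]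
  have e : Complex.exp (2 * Real.pi * Complex.I * (k i)) = 1 := by
    rw [mul_comm]; exact Complex.exp_int_mul_two_pi_mul_I _
  simp [e]

theorem inner_zakTerm {n : ℕ} {m m' : Fin n → ℤ} (h : m ≠ m') (K : L2Phase n) :
    inner ℂ (zakTerm m K) (zakTerm m' K) = 0 := by
  have hint := L2.integrable_inner (𝕜 := ℂ) (zakTerm m K) (zakTerm m' K)
  rw [L2.inner_def]
  have hae : (fun q => inner ℂ (zakTerm m K q) (zakTerm m' K q))
      =ᵐ[(torusSq n).prod volume] fun q =>
        (inner ℂ (K (latticePt m + q.1.1, q.2)) (K (latticePt m' + q.1.1, q.2))) *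
        Complex.exp (2 * Real.pi * Complex.I *
          ((inner ℝ (latticePt (m - m')) q.1.2 : ℝ) : ℂ)) := by
    filter_upwards [MemLp.coeFn_toLp (memLp_zakTermFun m (Lp.memLp K)),
      MemLp.coeFn_toLp (memLp_zakTermFun m' (Lp.memLp K))] with q h1 h2
    rw [zakTerm, zakTerm, h1, h2]
    have e1 : (latticePt (m - m') : E n) = latticePt m - latticePt m' := by
      ext i; simp [latticePt]
    simp only [zakTermFun, RCLike.inner_apply, map_mul, e1, inner_sub_left]
    rw [← Complex.exp_conj, mul_mul_mul_comm, ← Complex.exp_add]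
    congr 2
    simp only [map_neg, map_mul, Complex.conj_ofReal, Complex.conj_I, map_ofNat]
    push_cast
    ring
  rw [integral_congr_ae hae, integral_prod _ (hint.congr hae)]
  simp only [integral_mul_const]
  rw [torusSq, integral_prod_mul (fun ξ : E n => ∫ y : E n,
      (inner ℂ (K (latticePt m + ξ, y)) (K (latticePt m' + ξ, y)) : ℂ))
    (fun ξ' : E n => Complex.exp (2 * Real.pi * Complex.I *
          ((inner ℝ (latticePt (m - m')) ξ' : ℝ) : ℂ))),
    integral_character (sub_ne_zero.2 h), mul_zero]

theorem measurableSet_unitCube (n : ℕ) : MeasurableSet (unitCube n) := by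
  have h : unitCube n = ⋂ i, (fun ξ : E n => ξ i) ⁻¹' Set.Ico (0 : ℝ) 1 := by
    ext ξ; simp [unitCube]
  rw [h]
  exact MeasurableSet.iInter fun i => (by fun_prop : Measurable fun ξ : E n => ξ i) measurableSet_Ico

/-- The cylinder over the translated cube `m + [0, 1)ⁿ`. -/
def cubeCylinder {n : ℕ} (m : Fin n → ℤ) : Set (E n × E n) :=
  {p | -latticePt m + p.1 ∈ unitCube n}

theorem measurableSet_cubeCylinder {n : ℕ} (m : Fin n → ℤ) : MeasurableSet (cubeCylinder m) :=
  (by fun_prop : Measurable fun p : E n × E n => -latticePt m + p.1) (measurableSet_unitCube n)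

theorem disjoint_cubeCylinder (n : ℕ) :
    Pairwise (Function.onFun Disjoint (cubeCylinder : (Fin n → ℤ) → Set (E n × E n))) := by
  intro m m' hmm
  refine Set.disjoint_left.2 fun p h1 h2 => hmm (funext fun i => ?_)
  have a := h1 i
  have b := h2 i
  simp only [latticePt, PiLp.add_apply, PiLp.neg_apply, Set.mem_Ico] at a b
  have e1 : ⌊p.1 i⌋ = m i := Int.floor_eq_iff.2 ⟨by linarith [a.1], by linarith [a.2]⟩
  have e2 : ⌊p.1 i⌋ = m' i := Int.floor_eq_iff.2 ⟨by linarith [b.1], by linarith [b.2]⟩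
  exact e1.symm.trans e2

theorem enorm_zakTerm_sq {n : ℕ} (m : Fin n → ℤ) (K : L2Phase n) :
    ‖zakTerm m K‖ₑ ^ 2 = ∫⁻ p in cubeCylinder m, ‖K p‖ₑ ^ 2 := by
  rw [zakTerm, Lp.enorm_toLp, eLpNorm_two_sq]
  have hf : AEMeasurable (fun p : E n × E n => ‖K p‖ₑ ^ 2) volume :=
    (Lp.aestronglyMeasurable K).enorm.pow_const 2
  have hτ : MeasurePreserving (fun p : E n × E n => (latticePt m + p.1, p.2)) volume volume :=
    (measurePreserving_add_left (volume : Measure (E n)) (latticePt m)).prod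
      (MeasurePreserving.id (volume : Measure (E n)))
  have hμ : (torusMeasure n).prod (volume : Measure (E n)) =
      (volume : Measure (E n × E n)).restrict
        ((fun p : E n × E n => (latticePt m + p.1, p.2)) ⁻¹' cubeCylinder m) := by
    rw [Measure.volume_eq_prod, torusMeasure]
    nth_rewrite 2 [← Measure.restrict_univ (μ := (volume : Measure (E n)))]
    rw [Measure.prod_restrict]
    congr 1
    ext p
    simp [cubeCylinder]
  have hτ' := hτ.restrict_preimage (measurableSet_cubeCylinder m)
  rw [← hμ] at hτ'
  have hfst : MeasurePreserving (fun q : (E n × E n) × E n => (q.1.1, q.2))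
      ((torusSq n).prod volume) ((torusMeasure n).prod volume) :=
    (measurePreserving_fst (μ := torusMeasure n) (ν := torusMeasure n)).prod
      (MeasurePreserving.id (volume : Measure (E n)))
  have hall := hτ'.comp hfst
  rw [← hall.map_eq, lintegral_map' (hall.map_eq ▸ hf.restrict) hall.aemeasurable]
  refine lintegral_congr fun q => ?_
  have e : (-(2 * Real.pi * Complex.I * ((inner ℝ (latticePt m) q.1.2 : ℝ) : ℂ)))
      = Real.pi * Complex.I * ((-2 * inner ℝ (latticePt m) q.1.2 : ℝ) : ℂ) := by
    push_cast; ring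
  rw [zakTermFun, enorm_mul, e, ← enorm_norm (Complex.exp _), norm_exp_pi_I]
  simp

/-- The Zak series converges unconditionally in `L²(𝕋ⁿ × 𝕋ⁿ × ℝⁿ)`. -/
theorem summable_zakTerm {n : ℕ} (K : L2Phase n) : Summable fun m => zakTerm m K := by
  have horth : OrthogonalFamily ℂ (fun m : Fin n → ℤ => Submodule.span ℂ {zakTerm m K})
      fun m => (Submodule.span ℂ {zakTerm m K}).subtypeₗᵢ := by
    intro m m' hmm v w
    obtain ⟨a, ha⟩ := Submodule.mem_span_singleton.1 v.2
    obtain ⟨b, hb⟩ := Submodule.mem_span_singleton.1 w.2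
    change inner ℂ (v : L2Zak n) (w : L2Zak n) = 0
    rw [← ha, ← hb, inner_smul_left, inner_smul_right, inner_zakTerm hmm]
    simp
  refine (horth.summable_iff_norm_sq_summable
    fun m => ⟨zakTerm m K, Submodule.mem_span_singleton_self _⟩).2 ?_
  have hsum : ∑' m : Fin n → ℤ, ‖zakTerm m K‖ₑ ^ 2 ≠ ⊤ := by
    simp only [enorm_zakTerm_sq]
    rw [← lintegral_iUnion measurableSet_cubeCylinder (disjoint_cubeCylinder n)]
    refine ((setLIntegral_le_lintegral _ _).trans_lt ?_).ne
    rw [← eLpNorm_two_sq]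
    exact ENNReal.pow_lt_top (Lp.memLp K).2
  refine (ENNReal.summable_toReal hsum).congr fun m => ?_
  simp

/-- The Weyl-Zak transform `Z_W φ(ξ, ξ', η) = ∑_{m ∈ ℤⁿ} K_φ(m + ξ, η) e^{-2πi m·ξ'}`; the series,
whose terms are mutually orthogonal, is summed in `L²(𝕋ⁿ × 𝕋ⁿ × ℝⁿ)`. -/
def weylZak {n : ℕ} (φ : L2Phase n) : L2Zak n := ∑' m : Fin n → ℤ, zakTerm m (weylKernel n φ)

open Classical in
/-- The fiber `𝒥φ(ξ, ξ') ∈ L²(ℝⁿ)`, that is, the function `η ↦ Z_W φ(ξ, ξ', η)`. It is square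
integrable for almost every `(ξ, ξ')`; the value `0` is used on the remaining null set. -/
def fiber {n : ℕ} (φ : L2Phase n) (p : E n × E n) : L2Space n :=
  if h : MemLp (fun η : E n => weylZak φ (p, η)) 2 volume then h.toLp _ else 0

/-! ### Twisted shift-invariant spaces, range functions and range operators -/

/-- `V` is a twisted shift-invariant space: a closed subspace of `L²(ℝ²ⁿ)` that is invariant under
all twisted translations. -/
structure IsTwistedShiftInvariant {n : ℕ} (V : Submodule ℂ (L2Phase n)) : Prop where
  isClosed : IsClosed (V : Set (L2Phase n))
  translate_mem : ∀ (k l : Fin n → ℤ), ∀ f ∈ V, twistedTranslate k l f ∈ V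

/-- The bounded operator `U : V → L²(ℝ²ⁿ)` on the twisted shift-invariant space `V` is twisted shift
preserving: it commutes with all twisted translations. -/
def IsTwistedShiftPreserving {n : ℕ} {V : Submodule ℂ (L2Phase n)}
    (hV : IsTwistedShiftInvariant V) (U : V →L[ℂ] L2Phase n) : Prop :=
  ∀ (k l : Fin n → ℤ) (f : V),
    U ⟨twistedTranslate k l f, hV.translate_mem k l f f.2⟩ = twistedTranslate k l (U f)

/-- `J` is the range function of `V`, `J(ξ, ξ') = closure (span {𝒥f(ξ, ξ') : f ∈ V})` for almost
every `(ξ, ξ')`. As `𝒥f` is defined only up to a null set depending on `f`, the functions `f` range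
over a dense sequence in `V`; another sequence changes `J` only on a null set. -/
def IsRangeFunction {n : ℕ} (V : Submodule ℂ (L2Phase n))
    (J : E n × E n → ClosedSubmodule ℂ (L2Space n)) : Prop :=
  ∃ f : ℕ → V, DenseRange f ∧ ∀ᵐ p ∂torusSq n,
    (J p : Submodule ℂ (L2Space n)) =
      (Submodule.span ℂ (Set.range fun i => fiber (f i : L2Phase n) p)).topologicalClosure

/-- `R` is a measurable range operator on `J`: with `P(ξ, ξ')` the orthogonal projection onto
`J(ξ, ξ')`, all functions `⟨R(ξ, ξ') P(ξ, ξ') a, b⟩` are (Lebesgue) measurable. -/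
def IsMeasurableRangeOperator {n : ℕ} {J : E n × E n → ClosedSubmodule ℂ (L2Space n)}
    (R : ∀ p, (J p : Submodule ℂ (L2Space n)) →L[ℂ] L2Space n) : Prop :=
  ∀ a b : L2Space n, AEMeasurable
    (fun p => inner ℂ b (R p ((J p : Submodule ℂ (L2Space n)).orthogonalProjectionOnto a)))
    (torusSq n)

/-- `R` is the range operator corresponding to `U`: it is measurable and
`𝒥(U f)(ξ, ξ') = R(ξ, ξ')(𝒥f(ξ, ξ'))` for almost every `(ξ, ξ')`, for every `f ∈ V`. -/
structure IsRangeOperatorOf {n : ℕ} {V : Submodule ℂ (L2Phase n)} (U : V →L[ℂ] L2Phase n)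
    {J : E n × E n → ClosedSubmodule ℂ (L2Space n)}
    (R : ∀ p, (J p : Submodule ℂ (L2Space n)) →L[ℂ] L2Space n) : Prop where
  measurable : IsMeasurableRangeOperator R
  fiber_eq : ∀ f : V, ∀ᵐ p ∂torusSq n,
    ∃ h : fiber (f : L2Phase n) p ∈ (J p : Submodule ℂ (L2Space n)),
      fiber (U f) p = R p ⟨fiber (f : L2Phase n) p, h⟩

/-- The operator `A` is bounded below with the constant `c`. -/
def IsBoundedBelow {X Y : Type*} [NormedAddCommGroup X] [NormedSpace ℂ X]
    [NormedAddCommGroup Y] [NormedSpace ℂ Y] (A : X →L[ℂ] Y) (c : ℝ) : Prop :=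
  ∀ x : X, c * ‖x‖ ≤ ‖A x‖

end TwistedShift

end

/-! The Weyl-Zak transform is an isometry, so `‖φ‖²` is the integral of `‖𝒥φ(p)‖²` over the torus
(`lintegral_enorm_fiber_sq`). A lower bound for almost every `R p` therefore integrates to one for
`U`.

The converse must localize a global inequality. A twisted translation acts on fibers as
multiplication by a character, up to a constant phase (`fiber_twistedTranslate`). Since `U` commutes
with twisted translations, for every trigonometric polynomial `q` some `g ∈ V` has fibers `q · 𝒥f`
while `U g` has fibers `q · 𝒥(U f)` (`exists_fiber_eq_smul`). The bound for `g` reads `∫ c²‖𝒥f‖²|q|²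
≤ ∫ ‖𝒥(U f)‖²|q|²`. Trigonometric polynomials are dense in the continuous functions on the torus, so
the densities themselves are ordered almost everywhere (`ae_le_of_forall_trigonometric`).

This gives `c‖𝒥f(p)‖ ≤ ‖𝒥(U f)(p)‖` off a null set depending on `f`. Countably many finite
combinations of the sequence defining `J` share one null set, and their fibers are dense in `J p`;
continuity of `R p` does the rest (`isBoundedBelow_of_dense`). -/

noncomputable section

namespace TwistedShift

/-! ### Weighted composition operators on L². -/

section WeightedComp

variable {α β : Type*} [MeasurableSpace α] [MeasurableSpace β] {μ : Measure α} {ν : Measure β}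

/-- Domination `μ.map τ ≤ ν` replaces equality because a Zak term sees its kernel on only one
translated cube. -/
theorem eLpNorm_weightedComp_le {u : α → ℂ} (hu : ∀ x, ‖u x‖ = 1) {τ : α → β}
    (hτ : Measurable τ) (hμν : μ.map τ ≤ ν) {f : β → ℂ} (hf : AEStronglyMeasurable f ν) :
    eLpNorm (fun x => u x * f (τ x)) 2 μ ≤ eLpNorm f 2 ν := by
  have h : eLpNorm (fun x => u x * f (τ x)) 2 μ = eLpNorm (f ∘ τ) 2 μ :=
    eLpNorm_congr_norm_ae (Filter.Eventually.of_forall fun x => by simp [hu])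
  rw [h, ← eLpNorm_map_measure (hf.mono_measure hμν) hτ.aemeasurable]
  exact eLpNorm_mono_measure f hμν

theorem quasiMeasurePreserving_of_map_le {τ : α → β} (hτ : Measurable τ) (hμν : μ.map τ ≤ ν) :
    Measure.QuasiMeasurePreserving τ μ ν :=
  ⟨hτ, hμν.absolutelyContinuous⟩

theorem memLp_weightedComp {u : α → ℂ} (hum : AEStronglyMeasurable u μ) (hu : ∀ x, ‖u x‖ = 1)
    {τ : α → β} (hτ : Measurable τ) (hμν : μ.map τ ≤ ν) {f : β → ℂ} (hf : MemLp f 2 ν) :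
    MemLp (fun x => u x * f (τ x)) 2 μ :=
  ⟨hum.mul (hf.1.comp_quasiMeasurePreserving (quasiMeasurePreserving_of_map_le hτ hμν)),
    (eLpNorm_weightedComp_le hu hτ hμν hf.1).trans_lt hf.2⟩

/-- The operator `f ↦ u · (f ∘ τ)` from `L²(ν)` to `L²(μ)`, where `u` is unimodular and the
image of `μ` under `τ` is at most `ν`. -/
def weightedComp {u : α → ℂ} (hum : AEStronglyMeasurable u μ) (hu : ∀ x, ‖u x‖ = 1)
    {τ : α → β} (hτ : Measurable τ) (hμν : μ.map τ ≤ ν) : Lp ℂ 2 ν →L[ℂ] Lp ℂ 2 μ :=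
  LinearMap.mkContinuous
    { toFun := fun f => (memLp_weightedComp hum hu hτ hμν (Lp.memLp f)).toLp _
      map_add' := fun f g => by
        rw [← MemLp.toLp_add]
        refine MemLp.toLp_congr _ _ ?_
        filter_upwards [(quasiMeasurePreserving_of_map_le hτ hμν).ae (Lp.coeFn_add f g)] with x hx
        simp only [hx, Pi.add_apply, mul_add]
      map_smul' := fun c f => by
        rw [RingHom.id_apply, ← MemLp.toLp_const_smul]
        refine MemLp.toLp_congr _ _ ?_
        filter_upwards [(quasiMeasurePreserving_of_map_le hτ hμν).ae (Lp.coeFn_smul c f)] with x hx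
        simp only [hx, Pi.smul_apply, smul_eq_mul, mul_left_comm] }
    1 fun f => by
      rw [one_mul]
      change ‖(memLp_weightedComp hum hu hτ hμν (Lp.memLp f)).toLp _‖ ≤ _
      rw [Lp.norm_toLp, Lp.norm_def]
      exact ENNReal.toReal_mono (Lp.eLpNorm_ne_top f)
        (eLpNorm_weightedComp_le hu hτ hμν (Lp.aestronglyMeasurable f))

theorem coeFn_weightedComp {u : α → ℂ} (hum : AEStronglyMeasurable u μ) (hu : ∀ x, ‖u x‖ = 1)
    {τ : α → β} (hτ : Measurable τ) (hμν : μ.map τ ≤ ν) (f : Lp ℂ 2 ν) :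
    weightedComp hum hu hτ hμν f =ᵐ[μ] fun x => u x * f (τ x) :=
  MemLp.coeFn_toLp (memLp_weightedComp hum hu hτ hμν (Lp.memLp f))

end WeightedComp

/-! ### The twisted translations as bounded operators -/

theorem measurePreserving_sub_latticePt {n : ℕ} (k l : Fin n → ℤ) :
    MeasurePreserving (fun p : E n × E n => (p.1 - latticePt k, p.2 - latticePt l))
      volume volume :=
  (measurePreserving_sub_right volume (latticePt k)).prod
    (measurePreserving_sub_right volume (latticePt l))

theorem measurePreserving_latticePt_add {n : ℕ} (m : Fin n → ℤ) :
    MeasurePreserving (fun p : E n × E n => (latticePt m + p.1, p.2)) volume volume :=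
  (measurePreserving_add_left (volume : Measure (E n)) (latticePt m)).prod
    (MeasurePreserving.id (volume : Measure (E n)))

/-- The twisted translation as a bounded operator. -/
def twistedTranslateCLM {n : ℕ} (k l : Fin n → ℤ) : L2Phase n →L[ℂ] L2Phase n :=
  weightedComp (u := fun p : E n × E n => Complex.exp (Real.pi * Complex.I *
      ((inner ℝ p.1 (latticePt l) - inner ℝ p.2 (latticePt k) : ℝ) : ℂ)))
    (Continuous.aestronglyMeasurable (by fun_prop)) (fun _ => norm_exp_pi_I _)
    (measurePreserving_sub_latticePt k l).measurable
    (measurePreserving_sub_latticePt k l).map_eq.le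

theorem twistedTranslateCLM_apply {n : ℕ} (k l : Fin n → ℤ) (φ : L2Phase n) :
    twistedTranslateCLM k l φ = twistedTranslate k l φ := rfl

theorem coeFn_twistedTranslate {n : ℕ} (k l : Fin n → ℤ) (φ : L2Phase n) :
    twistedTranslate k l φ =ᵐ[volume] twistedTranslateFun k l φ :=
  MemLp.coeFn_toLp (memLp_twistedTranslateFun k l (Lp.memLp φ))

/-- The character `e^{πi k·l} e^{2πi k·ξ}`. -/
def kernelWeight {n : ℕ} (k l : Fin n → ℤ) (p : E n × E n) : ℂ :=
  Complex.exp (Real.pi * Complex.I *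
    ((inner ℝ (latticePt k) (latticePt l) + 2 * inner ℝ (latticePt k) p.1 : ℝ) : ℂ))

theorem norm_kernelWeight {n : ℕ} (k l : Fin n → ℤ) (p : E n × E n) : ‖kernelWeight k l p‖ = 1 :=
  norm_exp_pi_I _

/-- The action `K ↦ e^{πi k·l} e^{2πi k·ξ} K(l + ξ, η)` of a twisted translation on kernels. -/
def kernelTranslate {n : ℕ} (k l : Fin n → ℤ) : L2Phase n →L[ℂ] L2Phase n :=
  weightedComp (u := kernelWeight k l)
    (Continuous.aestronglyMeasurable (by unfold kernelWeight; fun_prop)) (norm_kernelWeight k l)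
    (measurePreserving_latticePt_add l).measurable (measurePreserving_latticePt_add l).map_eq.le

theorem coeFn_kernelTranslate {n : ℕ} (k l : Fin n → ℤ) (K : L2Phase n) :
    kernelTranslate k l K =ᵐ[volume] fun p => kernelWeight k l p * K (latticePt l + p.1, p.2) :=
  coeFn_weightedComp _ _ _ _ K

/-- Substitute `x + k` for `x`. The shift by `l` in the second variable moves onto `ξ`, since `η - ξ
- l = η - (l + ξ)`, and the phases left over collect to `k·l + 2 k·ξ`. No integrability is needed.
-/
theorem weylKernelFun_twistedTranslateFun {n : ℕ} (k l : Fin n → ℤ) (g : E n × E n → ℂ)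
    (p : E n × E n) : weylKernelFun (twistedTranslateFun k l g) p =
      kernelWeight k l p * weylKernelFun g (latticePt l + p.1, p.2) := by
  rw [weylKernelFun, weylKernelFun, ← integral_add_right_eq_self _ (latticePt k),
    ← integral_const_mul]
  refine integral_congr_ae (Filter.Eventually.of_forall fun x => ?_)
  simp only [twistedTranslateFun, kernelWeight, add_sub_cancel_right]
  rw [show p.2 - p.1 - latticePt l = p.2 - (latticePt l + p.1) by abel,
    mul_right_comm, ← Complex.exp_add, mul_left_comm, ← Complex.exp_add, mul_comm]
  congr 2
  simp only [inner_add_left, inner_add_right, inner_sub_left]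
  rw [real_inner_comm p.1 (latticePt k), real_inner_comm p.2 (latticePt k)]
  push_cast
  ring

theorem weylKernel_twistedTranslate {n : ℕ} (k l : Fin n → ℤ) (φ : L2Phase n) :
    weylKernel n (twistedTranslate k l φ) = kernelTranslate k l (weylKernel n φ) := by
  -- In operator form both sides are continuous in `φ`, so it suffices to treat the dense subspace
  -- `L¹ ∩ L²`, where the integral formula is available.
  rw [← twistedTranslateCLM_apply]
  refine (denseRange_integrableSubspace n).induction_on
    (p := fun φ => weylKernel n (twistedTranslateCLM k l φ) =
      kernelTranslate k l (weylKernel n φ)) φ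
    (isClosed_eq (by fun_prop) (by fun_prop)) fun f => ?_
  have hf : Integrable f.1 volume := f.2
  have hT : (twistedTranslateCLM k l f.1 : L2Phase n) =ᵐ[volume] twistedTranslateFun k l f.1 :=
    coeFn_twistedTranslate k l f.1
  have hTi : Integrable (twistedTranslateCLM k l f.1) volume := by
    refine Integrable.congr ?_ hT.symm
    have h1 := (measurePreserving_sub_latticePt k l).integrable_comp_of_integrable hf
    refine h1.bdd_mul (c := 1) ?_ (Filter.Eventually.of_forall fun x => (norm_exp_pi_I _).le)
    exact Continuous.aestronglyMeasurable (by fun_prop)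
  refine Lp.ext ?_
  change weylKernel n (twistedTranslateCLM k l f.1) =ᵐ[volume]
    kernelTranslate k l (weylKernel n f.1)
  filter_upwards [weylKernel_coeFn _ hTi, ae_slice hT,
    coeFn_kernelTranslate k l (weylKernel n f.1),
    (measurePreserving_latticePt_add l).quasiMeasurePreserving.ae (weylKernel_coeFn f.1 hf)]
    with p h1 h2 h3 h4
  rw [h1, h3, h4, ← weylKernelFun_twistedTranslateFun]
  refine integral_congr_ae ?_
  filter_upwards [h2] with x hx
  rw [hx]

/-! ### The Weyl-Zak transform is linear, isometric and intertwines translations and characters -/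

/-- Forgetting `ξ'` costs no factor because the torus has mass one; what remains is Lebesgue measure
on a translated cube cylinder. -/
theorem map_latticePt_add_le {n : ℕ} (m : Fin n → ℤ) :
    ((torusSq n).prod (volume : Measure (E n))).map
      (fun q : (E n × E n) × E n => (latticePt m + q.1.1, q.2)) ≤ volume := by
  have h1 : MeasurePreserving (fun q : (E n × E n) × E n => (q.1.1, q.2))
      ((torusSq n).prod volume) ((torusMeasure n).prod volume) :=
    (measurePreserving_fst (μ := torusMeasure n) (ν := torusMeasure n)).prod
      (MeasurePreserving.id (volume : Measure (E n)))
  have h2 := measurePreserving_latticePt_add m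
  have h3 : (fun q : (E n × E n) × E n => (latticePt m + q.1.1, q.2)) =
      (fun p : E n × E n => (latticePt m + p.1, p.2)) ∘ fun q => (q.1.1, q.2) := rfl
  rw [h3, ← Measure.map_map h2.measurable h1.measurable, h1.map_eq]
  calc _ ≤ (volume : Measure (E n × E n)).map (fun p : E n × E n => (latticePt m + p.1, p.2)) :=
        Measure.map_mono (Measure.prod_mono Measure.restrict_le_self le_rfl) h2.measurable
    _ = volume := h2.map_eq

theorem norm_zak_exp {n : ℕ} (m : Fin n → ℤ) (ξ : E n) :
    ‖Complex.exp (-(2 * Real.pi * Complex.I * ((inner ℝ (latticePt m) ξ : ℝ) : ℂ)))‖ = 1 := by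
  have e : (-(2 * Real.pi * Complex.I * ((inner ℝ (latticePt m) ξ : ℝ) : ℂ)))
      = Real.pi * Complex.I * ((-2 * inner ℝ (latticePt m) ξ : ℝ) : ℂ) := by
    push_cast; ring
  rw [e, norm_exp_pi_I]

/-- The `m`-th term of the Zak series as a bounded operator. -/
def zakTermCLM {n : ℕ} (m : Fin n → ℤ) : L2Phase n →L[ℂ] L2Zak n :=
  weightedComp (u := fun q : (E n × E n) × E n => Complex.exp
      (-(2 * Real.pi * Complex.I * ((inner ℝ (latticePt m) q.1.2 : ℝ) : ℂ))))
    (Continuous.aestronglyMeasurable (by fun_prop)) (fun _ => norm_zak_exp _ _)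
    (τ := fun q : (E n × E n) × E n => (latticePt m + q.1.1, q.2)) (by fun_prop)
    (map_latticePt_add_le m)

theorem zakTermCLM_apply {n : ℕ} (m : Fin n → ℤ) (K : L2Phase n) :
    zakTermCLM m K = zakTerm m K := by
  refine Lp.ext ?_
  filter_upwards [coeFn_weightedComp _ _ _ _ K,
    MemLp.coeFn_toLp (memLp_zakTermFun m (Lp.memLp K))] with q h1 h2
  rw [zakTerm, h2, zakTermFun, mul_comm]
  exact h1

theorem coeFn_zakTerm {n : ℕ} (m : Fin n → ℤ) (K : L2Phase n) :
    zakTerm m K =ᵐ[(torusSq n).prod volume] zakTermFun m K :=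
  MemLp.coeFn_toLp (memLp_zakTermFun m (Lp.memLp K))

theorem tsum_clm_add {ι G H : Type*} [NormedAddCommGroup G] [NormedSpace ℂ G]
    [NormedAddCommGroup H] [NormedSpace ℂ H] (A : ι → G →L[ℂ] H)
    (hA : ∀ x, Summable fun i => A i x) (x y : G) :
    ∑' i, A i (x + y) = ∑' i, A i x + ∑' i, A i y := by
  simp only [map_add]
  exact (hA x).tsum_add (hA y)

theorem tsum_clm_smul {ι G H : Type*} [NormedAddCommGroup G] [NormedSpace ℂ G]
    [NormedAddCommGroup H] [NormedSpace ℂ H] (A : ι → G →L[ℂ] H)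
    (hA : ∀ x, Summable fun i => A i x) (c : ℂ) (x : G) :
    ∑' i, A i (c • x) = c • ∑' i, A i x := by
  simp only [map_smul]
  exact (hA x).tsum_const_smul c

theorem tsum_clm_comp_equiv {ι G H : Type*} [NormedAddCommGroup G] [NormedSpace ℂ G]
    [NormedAddCommGroup H] [NormedSpace ℂ H] (A : G →L[ℂ] H) (e : ι ≃ ι) {z : ι → G}
    (hz : Summable z) : ∑' i, A (z (e i)) = A (∑' i, z i) := by
  rw [e.tsum_eq fun i => A (z i), A.map_tsum hz]

theorem summable_zakTermCLM {n : ℕ} (K : L2Phase n) : Summable fun m => zakTermCLM m K :=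
  (summable_zakTerm K).congr fun m => (zakTermCLM_apply m K).symm

theorem weylZak_eq_tsum {n : ℕ} (φ : L2Phase n) :
    weylZak φ = ∑' m, zakTermCLM m (weylKernel n φ) := by
  simp only [zakTermCLM_apply, weylZak]

theorem weylZak_add {n : ℕ} (φ ψ : L2Phase n) : weylZak (φ + ψ) = weylZak φ + weylZak ψ := by
  rw [weylZak_eq_tsum, weylZak_eq_tsum, weylZak_eq_tsum, map_add]
  exact tsum_clm_add _ summable_zakTermCLM _ _

theorem weylZak_smul {n : ℕ} (c : ℂ) (φ : L2Phase n) : weylZak (c • φ) = c • weylZak φ := by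
  rw [weylZak_eq_tsum, weylZak_eq_tsum, map_smul]
  exact tsum_clm_smul _ summable_zakTermCLM _ _

theorem iUnion_cubeCylinder (n : ℕ) :
    ⋃ m : Fin n → ℤ, (cubeCylinder m : Set (E n × E n)) = Set.univ := by
  refine Set.eq_univ_of_forall fun p => Set.mem_iUnion.2 ⟨fun i => ⌊p.1 i⌋, fun i => ?_⟩
  simp only [latticePt, PiLp.add_apply, PiLp.neg_apply, Set.mem_Ico]
  constructor <;> linarith [Int.floor_le (p.1 i), Int.lt_floor_add_one (p.1 i)]

/-- Each term carries the mass of `K` over one translated cube, and these cubes tile the space. -/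
theorem tsum_enorm_zakTerm_sq {n : ℕ} (K : L2Phase n) :
    ∑' m : Fin n → ℤ, ‖zakTerm m K‖ₑ ^ 2 = ‖K‖ₑ ^ 2 := by
  simp only [enorm_zakTerm_sq]
  rw [← lintegral_iUnion measurableSet_cubeCylinder (disjoint_cubeCylinder n),
    iUnion_cubeCylinder, Measure.restrict_univ, ← eLpNorm_two_sq, Lp.enorm_def]

/-- Pythagoras for a series: pairing the sum with `z i` leaves only `‖z i‖²`, and pairing the sum
with itself adds these up. -/
theorem inner_tsum_self_of_orthogonal {ι H : Type*} [NormedAddCommGroup H] [InnerProductSpace ℂ H]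
    {z : ι → H} (hz : Summable z) (h : ∀ i j, i ≠ j → inner ℂ (z i) (z j) = 0) :
    HasSum (fun i => ‖z i‖ ^ 2) (‖∑' i, z i‖ ^ 2) := by
  have h1 : ∀ i, inner ℂ (z i) (∑' j, z j) = (‖z i‖ : ℂ) ^ 2 := by
    intro i
    have := (hz.hasSum.mapL (innerSL ℂ (z i))).tsum_eq
    simp only [innerSL_apply_apply] at this
    rw [← this, tsum_eq_single i fun j hj => h i j hj.symm, inner_self_eq_norm_sq_to_K]
    rfl
  have h2 := hz.hasSum.mapL (innerSL ℂ (∑' j, z j))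
  simp only [innerSL_apply_apply] at h2
  have h3 : ∀ i, inner ℂ (∑' j, z j) (z i) = (‖z i‖ : ℂ) ^ 2 := by
    intro i
    rw [← inner_conj_symm, h1]
    simp
  simp only [h3, inner_self_eq_norm_sq_to_K] at h2
  have h4 := Complex.reCLM.hasSum h2
  simpa [← Complex.ofReal_pow] using h4

/-- Orthogonality of the Zak terms, the tiling by cubes and the Plancherel formula for the Weyl
kernel combine to an isometry. -/
theorem enorm_weylZak {n : ℕ} (φ : L2Phase n) : ‖weylZak φ‖ₑ = ‖φ‖ₑ := by
  have h1 := inner_tsum_self_of_orthogonal (summable_zakTerm (weylKernel n φ))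
    fun i j hij => inner_zakTerm hij _
  have h2 : ∑' m : Fin n → ℤ, ‖zakTerm m (weylKernel n φ)‖ₑ ^ 2 = ‖weylZak φ‖ₑ ^ 2 := by
    have h3 : ∀ m : Fin n → ℤ, ‖zakTerm m (weylKernel n φ)‖ₑ ^ 2 =
        ENNReal.ofReal (‖zakTerm m (weylKernel n φ)‖ ^ 2) := fun m => by
      rw [ENNReal.ofReal_pow (norm_nonneg _), ofReal_norm]
    simp only [h3]
    rw [← ENNReal.ofReal_tsum_of_nonneg (fun m => by positivity) h1.summable, h1.tsum_eq,
      ENNReal.ofReal_pow (norm_nonneg _), ofReal_norm]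
    rfl
  rw [tsum_enorm_zakTerm_sq] at h2
  have h4 := (ENNReal.pow_right_strictMono two_ne_zero).injective h2
  rw [← h4, ← ofReal_norm, norm_weylKernel, ofReal_norm]

/-- The character `e^{πi k·l} e^{2πi (k·ξ + l·ξ')}`. -/
def zakWeight {n : ℕ} (k l : Fin n → ℤ) (p : E n × E n) : ℂ :=
  Complex.exp (Real.pi * Complex.I * ((inner ℝ (latticePt k) (latticePt l) +
    2 * (inner ℝ (latticePt k) p.1 + inner ℝ (latticePt l) p.2) : ℝ) : ℂ))

theorem norm_zakWeight {n : ℕ} (k l : Fin n → ℤ) (p : E n × E n) : ‖zakWeight k l p‖ = 1 :=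
  norm_exp_pi_I _

/-- Multiplication by `zakWeight k l` on `L²(𝕋ⁿ × 𝕋ⁿ × ℝⁿ)`. -/
def zakModulate {n : ℕ} (k l : Fin n → ℤ) : L2Zak n →L[ℂ] L2Zak n :=
  weightedComp (u := fun q : (E n × E n) × E n => zakWeight k l q.1)
    (Continuous.aestronglyMeasurable (by unfold zakWeight; fun_prop)) (fun q => norm_zakWeight k l q.1)
    measurable_id Measure.map_id.le

theorem coeFn_zakModulate {n : ℕ} (k l : Fin n → ℤ) (Z : L2Zak n) :
    zakModulate k l Z =ᵐ[(torusSq n).prod volume] fun q => zakWeight k l q.1 * Z q :=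
  coeFn_weightedComp _ _ _ _ Z

theorem exp_two_pi_I_inner_latticePt {n : ℕ} (k m : Fin n → ℤ) :
    Complex.exp (2 * Real.pi * Complex.I *
      ((inner ℝ (latticePt k) (latticePt m) : ℝ) : ℂ)) = 1 := by
  have h : (inner ℝ (latticePt k : E n) (latticePt m) : ℝ) = ((∑ i, k i * m i : ℤ) : ℝ) := by
    simp [latticePt, PiLp.inner_apply, mul_comm]
  rw [h, mul_comm]
  exact_mod_cast Complex.exp_int_mul_two_pi_mul_I (∑ i, k i * m i)

/-- Translating `ξ` by `l` renumbers the Zak series and leaves the factor `e^{2πi l·ξ'}`; modulation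
in `ξ` passes through the series because it is periodic. -/
theorem zakTerm_kernelTranslate {n : ℕ} (k l m : Fin n → ℤ) (K : L2Phase n) :
    zakTerm m (kernelTranslate k l K) = zakModulate k l (zakTerm (m + l) K) := by
  refine Lp.ext ?_
  filter_upwards [coeFn_zakTerm m (kernelTranslate k l K), coeFn_zakTerm (m + l) K,
    (quasiMeasurePreserving_of_map_le (by fun_prop) (map_latticePt_add_le m)).ae
      (coeFn_kernelTranslate k l K), coeFn_zakModulate k l (zakTerm (m + l) K)] with q h1 h2 h3 h4
  rw [h1, h4, h2, zakTermFun, zakTermFun, h3]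
  have e : (latticePt (m + l) : E n) = latticePt l + latticePt m := by
    ext i; simp [latticePt, add_comm]
  rw [e, ← add_assoc, mul_right_comm, mul_left_comm, mul_comm]
  congr 1
  simp only [kernelWeight, zakWeight]
  rw [← Complex.exp_add, ← Complex.exp_add]
  -- The left side evaluates the modulation at `m + ξ`, so the trivial factor `e^{2πi k·m} = 1` is
  -- inserted on the right to match exponents.
  conv_rhs => rw [← mul_one (Complex.exp _), ← exp_two_pi_I_inner_latticePt k m, ← Complex.exp_add]
  congr 1
  simp only [inner_add_left, inner_add_right]
  push_cast
  ring

theorem weylZak_twistedTranslate {n : ℕ} (k l : Fin n → ℤ) (φ : L2Phase n) :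
    weylZak (twistedTranslate k l φ) = zakModulate k l (weylZak φ) := by
  rw [weylZak, weylZak, weylKernel_twistedTranslate]
  simp only [zakTerm_kernelTranslate]
  exact tsum_clm_comp_equiv _ (Equiv.addRight l) (summable_zakTerm _)

/-! ### Fibers -/

/-- By Tonelli almost every slice of `weylZak φ` is square integrable, so the default value `0` in
`fiber` matters only on a null set. -/
theorem ae_coeFn_fiber {n : ℕ} (φ : L2Phase n) :
    ∀ᵐ p ∂torusSq n, fiber φ p =ᵐ[volume] fun η => weylZak φ (p, η) := by
  have hm := Lp.aestronglyMeasurable (weylZak φ)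
  have hfin : ∫⁻ q, ‖weylZak φ q‖ₑ ^ 2 ∂((torusSq n).prod volume) ≠ ⊤ := by
    rw [← eLpNorm_two_sq]
    exact (ENNReal.pow_lt_top (Lp.memLp (weylZak φ)).2).ne
  have hme : AEMeasurable (fun q => ‖weylZak φ q‖ₑ ^ 2)
      ((torusSq n).prod (volume : Measure (E n))) := hm.enorm.pow_const 2
  rw [lintegral_prod _ hme] at hfin
  filter_upwards [hm.prodMk_left, ae_lt_top' hme.lintegral_prod_right' hfin] with p h1 h2
  have h : MemLp (fun η : E n => weylZak φ (p, η)) 2 volume := by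
    refine ⟨h1, ?_⟩
    rw [← eLpNorm_two_sq] at h2
    exact (ENNReal.pow_lt_top_iff.1 h2).resolve_right two_ne_zero
  rw [fiber, dif_pos h]
  exact h.coeFn_toLp

theorem ae_enorm_fiber_sq {n : ℕ} (φ : L2Phase n) :
    ∀ᵐ p ∂torusSq n, ‖fiber φ p‖ₑ ^ 2 = ∫⁻ η, ‖weylZak φ (p, η)‖ₑ ^ 2 := by
  filter_upwards [ae_coeFn_fiber φ] with p hp
  rw [Lp.enorm_def, eLpNorm_congr_ae hp, eLpNorm_two_sq]

theorem aemeasurable_enorm_fiber_sq {n : ℕ} (φ : L2Phase n) :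
    AEMeasurable (fun p => ‖fiber φ p‖ₑ ^ 2) (torusSq n) := by
  have hme : AEMeasurable (fun q => ‖weylZak φ q‖ₑ ^ 2)
      ((torusSq n).prod (volume : Measure (E n))) :=
    (Lp.aestronglyMeasurable (weylZak φ)).enorm.pow_const 2
  exact hme.lintegral_prod_right'.congr (Filter.EventuallyEq.symm (ae_enorm_fiber_sq φ))

theorem lintegral_enorm_fiber_sq {n : ℕ} (φ : L2Phase n) :
    ∫⁻ p, ‖fiber φ p‖ₑ ^ 2 ∂torusSq n = ‖φ‖ₑ ^ 2 := by
  have hme : AEMeasurable (fun q => ‖weylZak φ q‖ₑ ^ 2)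
      ((torusSq n).prod (volume : Measure (E n))) :=
    (Lp.aestronglyMeasurable (weylZak φ)).enorm.pow_const 2
  rw [lintegral_congr_ae (ae_enorm_fiber_sq φ), ← lintegral_prod _ hme, ← eLpNorm_two_sq,
    ← Lp.enorm_def, enorm_weylZak]

/-- The exceptional null set depends on `φ` and `ψ`; only countably many such identities may be used
at once. -/
theorem fiber_add {n : ℕ} (φ ψ : L2Phase n) :
    ∀ᵐ p ∂torusSq n, fiber (φ + ψ) p = fiber φ p + fiber ψ p := by
  have h := Lp.coeFn_add (weylZak φ) (weylZak ψ)
  rw [← weylZak_add] at h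
  filter_upwards [ae_coeFn_fiber φ, ae_coeFn_fiber ψ, ae_coeFn_fiber (φ + ψ),
    Measure.ae_ae_of_ae_prod h] with p h1 h2 h3 h4
  refine Lp.ext ?_
  filter_upwards [h1, h2, h3, h4, Lp.coeFn_add (fiber φ p) (fiber ψ p)] with η e1 e2 e3 e4 e5
  rw [e3, e4, e5, Pi.add_apply, Pi.add_apply, e1, e2]

theorem fiber_smul {n : ℕ} (c : ℂ) (φ : L2Phase n) :
    ∀ᵐ p ∂torusSq n, fiber (c • φ) p = c • fiber φ p := by
  have h := Lp.coeFn_smul c (weylZak φ)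
  rw [← weylZak_smul] at h
  filter_upwards [ae_coeFn_fiber φ, ae_coeFn_fiber (c • φ),
    Measure.ae_ae_of_ae_prod h] with p h1 h3 h4
  refine Lp.ext ?_
  filter_upwards [h1, h3, h4, Lp.coeFn_smul c (fiber φ p)] with η e1 e3 e4 e5
  rw [e3, e4, e5, Pi.smul_apply, Pi.smul_apply, e1]

theorem fiber_zero (n : ℕ) : ∀ᵐ p ∂torusSq n, fiber (0 : L2Phase n) p = 0 := by
  filter_upwards [fiber_smul (0 : ℂ) (0 : L2Phase n)] with p hp
  simpa using hp

theorem fiber_sum_smul {n : ℕ} {ι : Type*} (s : Finset ι) (a : ι → ℂ) (φ : ι → L2Phase n) :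
    ∀ᵐ p ∂torusSq n, fiber (∑ i ∈ s, a i • φ i) p = ∑ i ∈ s, a i • fiber (φ i) p := by
  classical
  induction s using Finset.induction_on with
  | empty => simpa using fiber_zero n
  | insert i s hi ih =>
    simp only [Finset.sum_insert hi]
    filter_upwards [ih, fiber_add (a i • φ i) (∑ i ∈ s, a i • φ i), fiber_smul (a i) (φ i)]
      with p h1 h2 h3
    rw [h2, h1, h3]

theorem fiber_twistedTranslate {n : ℕ} (k l : Fin n → ℤ) (φ : L2Phase n) :
    ∀ᵐ p ∂torusSq n, fiber (twistedTranslate k l φ) p = zakWeight k l p • fiber φ p := by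
  have h := coeFn_zakModulate k l (weylZak φ)
  rw [← weylZak_twistedTranslate] at h
  filter_upwards [ae_coeFn_fiber φ, ae_coeFn_fiber (twistedTranslate k l φ),
    Measure.ae_ae_of_ae_prod h] with p h1 h3 h4
  refine Lp.ext ?_
  filter_upwards [h1, h3, h4, Lp.coeFn_smul (zakWeight k l p) (fiber φ p)] with η e1 e3 e4 e5
  rw [e3, e4, e5, Pi.smul_apply, e1, smul_eq_mul]

/-! ### Comparison of densities on the torus through trigonometric polynomials -/

section Comparison

variable {X : Type*} [TopologicalSpace X] [CompactSpace X] [MeasurableSpace X] [BorelSpace X]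
  {μ ν : Measure X} [IsFiniteMeasure μ] [IsFiniteMeasure ν]

/-- For a finite measure the map from continuous functions with the uniform norm to L² is
continuous, so the inequality is a closed condition. -/
theorem eLpNorm_le_of_dense {D : Set C(X, ℂ)} (hD : Dense D)
    (h : ∀ q ∈ D, eLpNorm q 2 μ ≤ eLpNorm q 2 ν) (q : C(X, ℂ)) :
    eLpNorm q 2 μ ≤ eLpNorm q 2 ν := by
  have key : ∀ (ρ : Measure X) [IsFiniteMeasure ρ] (q : C(X, ℂ)),
      ‖ContinuousMap.toLp (E := ℂ) 2 ρ ℂ q‖ₑ = eLpNorm q 2 ρ := fun ρ _ q => by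
    rw [Lp.enorm_def, eLpNorm_congr_ae (ContinuousMap.coeFn_toLp ρ q)]
  rw [← key, ← key]
  refine hD.induction (P := fun q => ‖ContinuousMap.toLp (E := ℂ) 2 μ ℂ q‖ₑ ≤
    ‖ContinuousMap.toLp (E := ℂ) 2 ν ℂ q‖ₑ) (fun q hq => ?_) (isClosed_le ?_ ?_) q
  · rw [key, key]
    exact h q hq
  · exact continuous_enorm.comp (ContinuousLinearMap.continuous _)
  · exact continuous_enorm.comp (ContinuousLinearMap.continuous _)

/-- The measure of a Borel set is the squared L² norm of its indicator, which is a limit of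
continuous functions. -/
theorem measure_le_of_eLpNorm_le_of_dense [TopologicalSpace.PseudoMetrizableSpace X]
    {D : Set C(X, ℂ)} (hD : Dense D)
    (h : ∀ q ∈ D, eLpNorm q 2 μ ≤ eLpNorm q 2 ν) : μ ≤ ν := by
  refine Measure.le_iff.2 fun B hB => ?_
  set b : X → ℂ := B.indicator fun _ => 1 with hb
  have hind : ∀ ρ : Measure X, eLpNorm b 2 ρ ^ 2 = ρ B := fun ρ => by
    rw [eLpNorm_two_sq, ← lintegral_indicator_one hB]
    refine lintegral_congr fun x => ?_
    by_cases hx : x ∈ B <;> simp [hb, hx]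
  have hmem : MemLp b 2 (μ + ν) := memLp_indicator_const 2 hB 1 (Or.inr (measure_ne_top _ _))
  have key : eLpNorm b 2 μ ≤ eLpNorm b 2 ν := by
    refine ENNReal.le_of_forall_pos_le_add fun ε hε _ => ?_
    have hε' : ((ε / 2 : NNReal) : ENNReal) ≠ 0 := by
      exact_mod_cast (half_pos hε).ne'
    -- Approximating in L² of `μ + ν` controls the error for both measures with the same `g₀`; each
    -- error takes half of `ε`.
    obtain ⟨g₀, hg₀, -⟩ := hmem.exists_boundedContinuous_eLpNorm_sub_le (by norm_num) hε'
    obtain ⟨g, hgc, hgg, hg⟩ : ∃ g : X → ℂ, Continuous g ∧ eLpNorm g 2 μ ≤ eLpNorm g 2 ν ∧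
        eLpNorm (b - g) 2 (μ + ν) ≤ (ε / 2 : NNReal) :=
      ⟨g₀, g₀.continuous, eLpNorm_le_of_dense hD h g₀.toContinuousMap, hg₀⟩
    have hgm : ∀ ρ : Measure X, AEStronglyMeasurable g ρ := fun ρ =>
      hgc.aestronglyMeasurable
    have hbm : ∀ ρ : Measure X, AEStronglyMeasurable b ρ := fun ρ =>
      (stronglyMeasurable_const.indicator hB).aestronglyMeasurable
    have h1 : eLpNorm (b - g) 2 μ ≤ (ε / 2 : NNReal) :=
      (eLpNorm_mono_measure _ (Measure.le_add_right le_rfl)).trans hg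
    have h2 : eLpNorm (g - b) 2 ν ≤ (ε / 2 : NNReal) := by
      rw [← neg_sub, eLpNorm_neg]
      exact (eLpNorm_mono_measure _ (Measure.le_add_left le_rfl)).trans hg
    calc eLpNorm b 2 μ = eLpNorm ((b - g) + g) 2 μ := by rw [sub_add_cancel]
      _ ≤ eLpNorm (b - g) 2 μ + eLpNorm g 2 μ :=
        eLpNorm_add_le ((hbm μ).sub (hgm μ)) (hgm μ) (by norm_num)
      _ ≤ (ε / 2 : NNReal) + eLpNorm g 2 ν :=
        add_le_add h1 hgg
      _ = (ε / 2 : NNReal) + eLpNorm ((g - b) + b) 2 ν := by rw [sub_add_cancel]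
      _ ≤ (ε / 2 : NNReal) + (eLpNorm (g - b) 2 ν + eLpNorm b 2 ν) := by
        gcongr
        exact eLpNorm_add_le ((hgm ν).sub (hbm ν)) (hbm ν) (by norm_num)
      _ ≤ (ε / 2 : NNReal) + ((ε / 2 : NNReal) + eLpNorm b 2 ν) := by gcongr
      _ = eLpNorm b 2 ν + ε := by
        rw [← add_assoc, ← ENNReal.coe_add, add_halves, add_comm]
  rw [← hind, ← hind]
  gcongr

end Comparison

/-! ### Transfer between the unit cube and the compact torus. -/

/-- The covering map of the torus `𝕋ⁿ × 𝕋ⁿ`. -/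
def torusMap {n : ℕ} (p : E n × E n) : UnitAddTorus (Fin n ⊕ Fin n) :=
  Sum.elim (fun i => (p.1 i : UnitAddCircle)) fun i => (p.2 i : UnitAddCircle)

theorem continuous_torusMap (n : ℕ) : Continuous (torusMap : E n × E n → _) := by
  refine continuous_pi fun i => ?_
  rcases i with i | i
  · exact (AddCircle.continuous_mk' 1).comp (by fun_prop : Continuous fun p : E n × E n => p.1 i)
  · exact (AddCircle.continuous_mk' 1).comp (by fun_prop : Continuous fun p : E n × E n => p.2 i)

theorem eq_of_coe_unitAddCircle_eq {x y : ℝ} (hx : x ∈ Set.Ico (0 : ℝ) 1)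
    (hy : y ∈ Set.Ico (0 : ℝ) 1) (h : (x : UnitAddCircle) = y) : x = y :=
  (AddCircle.coe_eq_coe_iff_of_mem_Ico (p := (1 : ℝ)) (a := 0) (by simpa using hx)
    (by simpa using hy)).1 h

theorem injOn_torusMap (n : ℕ) :
    Set.InjOn (torusMap : E n × E n → _) (unitCube n ×ˢ unitCube n) := by
  rintro p ⟨hp1, hp2⟩ q ⟨hq1, hq2⟩ h
  refine Prod.ext (PiLp.ext fun i => ?_) (PiLp.ext fun i => ?_)
  · exact eq_of_coe_unitAddCircle_eq (hp1 i) (hq1 i) (congrFun h (Sum.inl i))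
  · exact eq_of_coe_unitAddCircle_eq (hp2 i) (hq2 i) (congrFun h (Sum.inr i))

theorem mFourier_torusMap {n : ℕ} (k l : Fin n → ℤ) (p : E n × E n) :
    UnitAddTorus.mFourier (Sum.elim k l) (torusMap p) =
      Complex.exp (2 * Real.pi * Complex.I *
        ((inner ℝ (latticePt k) p.1 + inner ℝ (latticePt l) p.2 : ℝ) : ℂ)) := by
  simp only [UnitAddTorus.mFourier, ContinuousMap.coe_mk, Fintype.prod_sum_type, torusMap,
    Sum.elim_inl, Sum.elim_inr, fourier_coe_apply, ← Complex.exp_sum, ← Complex.exp_add,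
    PiLp.inner_apply, latticePt]
  congr 1
  push_cast
  rw [mul_add, Finset.mul_sum, Finset.mul_sum]
  congr 1 <;> refine Finset.sum_congr rfl fun i _ => ?_ <;> simp <;> ring

theorem ae_mem_unitCube_prod (n : ℕ) : ∀ᵐ p ∂torusSq n, p ∈ unitCube n ×ˢ unitCube n := by
  rw [torusSq, torusMeasure, Measure.prod_restrict]
  exact ae_restrict_mem ((measurableSet_unitCube n).prod (measurableSet_unitCube n))

/-- Since `torusMap` is injective on the cube, the image of a Borel set there is Borel and pulls
back to that set up to a null set. Comparing measures on the compact torus thus compares integrals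
over all measurable sets `A`. -/
theorem map_torusMap_image {n : ℕ} (F : E n × E n → ENNReal) {A : Set (E n × E n)}
    (hA : MeasurableSet A) :
    ((torusSq n).withDensity F).map torusMap (torusMap '' (A ∩ unitCube n ×ˢ unitCube n)) =
      ∫⁻ p in A, F p ∂torusSq n := by
  have hB : MeasurableSet (torusMap '' (A ∩ unitCube n ×ˢ unitCube n)) :=
    (hA.inter ((measurableSet_unitCube n).prod (measurableSet_unitCube n))).image_of_continuousOn_injOn
      (continuous_torusMap n).continuousOn ((injOn_torusMap n).mono Set.inter_subset_right)
  rw [Measure.map_apply (continuous_torusMap n).measurable hB,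
    withDensity_apply _ ((continuous_torusMap n).measurable hB)]
  refine setLIntegral_congr ?_
  filter_upwards [ae_mem_unitCube_prod n] with p hp
  refine propext ⟨?_, fun h => ⟨p, ⟨h, hp⟩, rfl⟩⟩
  rintro ⟨q, ⟨hqA, hq⟩, hqp⟩
  rwa [← injOn_torusMap n hq hp hqp]

theorem eLpNorm_map_torusMap {n : ℕ} {F : E n × E n → ENNReal} (hF : AEMeasurable F (torusSq n))
    (q : C(UnitAddTorus (Fin n ⊕ Fin n), ℂ)) :
    eLpNorm q 2 (((torusSq n).withDensity F).map torusMap) ^ 2 =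
      ∫⁻ p, F p * ‖q (torusMap p)‖ₑ ^ 2 ∂torusSq n := by
  have hq : Measurable fun x => ‖q x‖ₑ ^ 2 := q.continuous.measurable.enorm.pow_const 2
  rw [eLpNorm_two_sq, lintegral_map hq (continuous_torusMap n).measurable]
  exact lintegral_withDensity_eq_lintegral_mul₀ hF
    (hq.comp (continuous_torusMap n).measurable).aemeasurable

/-- Two densities on the torus are comparable if their integrals against all squares of absolute
values of trigonometric polynomials are. -/
theorem ae_le_of_forall_trigonometric {n : ℕ} {F G : E n × E n → ENNReal}
    (hF : AEMeasurable F (torusSq n)) (hG : AEMeasurable G (torusSq n))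
    (hF' : ∫⁻ p, F p ∂torusSq n ≠ ⊤) (hG' : ∫⁻ p, G p ∂torusSq n ≠ ⊤)
    (h : ∀ q ∈ Submodule.span ℂ (Set.range (UnitAddTorus.mFourier (d := Fin n ⊕ Fin n))),
      ∫⁻ p, G p * ‖q (torusMap p)‖ₑ ^ 2 ∂torusSq n ≤
        ∫⁻ p, F p * ‖q (torusMap p)‖ₑ ^ 2 ∂torusSq n) :
    ∀ᵐ p ∂torusSq n, G p ≤ F p := by
  have := isFiniteMeasure_withDensity hF'
  have := isFiniteMeasure_withDensity hG'
  have hD : Dense (Submodule.span ℂ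
      (Set.range (UnitAddTorus.mFourier (d := Fin n ⊕ Fin n))) :
      Set C(UnitAddTorus (Fin n ⊕ Fin n), ℂ)) :=
    (Submodule.dense_iff_topologicalClosure_eq_top).2 UnitAddTorus.span_mFourier_closure_eq_top
  have hle : ((torusSq n).withDensity G).map torusMap ≤ ((torusSq n).withDensity F).map torusMap :=
    measure_le_of_eLpNorm_le_of_dense hD fun q hq => by
      rw [← ENNReal.pow_le_pow_left_iff two_ne_zero, eLpNorm_map_torusMap hG,
        eLpNorm_map_torusMap hF]
      exact h q hq
  refine ae_le_of_forall_setLIntegral_le_of_sigmaFinite₀ hG fun A hA _ => ?_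
  rw [← map_torusMap_image G hA, ← map_torusMap_image F hA]
  exact hle _

/-! ### Multiplication of fibers by trigonometric polynomials -/

/-- Characters are realized by twisted translates and general `q` by linearity. One `g` serves both
claims because `U` is linear and commutes with the translations. -/
theorem exists_fiber_eq_smul {n : ℕ} {V : Submodule ℂ (L2Phase n)}
    (hV : IsTwistedShiftInvariant V) {U : V →L[ℂ] L2Phase n} (hU : IsTwistedShiftPreserving hV U)
    (f : V) {q : C(UnitAddTorus (Fin n ⊕ Fin n), ℂ)}
    (hq : q ∈ Submodule.span ℂ (Set.range (UnitAddTorus.mFourier (d := Fin n ⊕ Fin n)))) :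
    ∃ g : V, (∀ᵐ p ∂torusSq n,
      fiber (g : L2Phase n) p = q (torusMap p) • fiber (f : L2Phase n) p) ∧
      ∀ᵐ p ∂torusSq n, fiber (U g) p = q (torusMap p) • fiber (U f) p := by
  induction hq using Submodule.span_induction with
  | mem q hq =>
    obtain ⟨j, rfl⟩ := hq
    set k : Fin n → ℤ := fun i => j (Sum.inl i) with hk
    set l : Fin n → ℤ := fun i => j (Sum.inr i) with hl
    have hj : j = Sum.elim k l := by ext (i | i) <;> rfl
    -- The scalar `a = e^{-πi k·l}` cancels the constant phase of `zakWeight`, leaving the pure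
    -- character.
    set a : ℂ := Complex.exp (Real.pi * Complex.I *
      ((-inner ℝ (latticePt k) (latticePt l : E n) : ℝ) : ℂ)) with ha
    have key : ∀ p : E n × E n,
        a * zakWeight k l p = UnitAddTorus.mFourier j (torusMap p) := fun p => by
      rw [hj, mFourier_torusMap, zakWeight, ha, ← Complex.exp_add]
      congr 1
      push_cast
      ring
    refine ⟨a • ⟨twistedTranslate k l f, hV.translate_mem k l f f.2⟩, ?_, ?_⟩
    · filter_upwards [fiber_smul a (twistedTranslate k l (f : L2Phase n)),
        fiber_twistedTranslate k l (f : L2Phase n)] with p h1 h2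
      rw [← key, mul_smul, ← h2, ← h1]
      rfl
    · rw [map_smul, hU]
      filter_upwards [fiber_smul a (twistedTranslate k l (U f)),
        fiber_twistedTranslate k l (U f)] with p h1 h2
      rw [← key, mul_smul, ← h2, ← h1]
  | zero =>
    refine ⟨0, ?_, ?_⟩
    · filter_upwards [fiber_zero n] with p hp
      simpa using hp
    · filter_upwards [fiber_zero n] with p hp
      simpa using hp
  | add q r _ _ hq hr =>
    obtain ⟨g, hg1, hg2⟩ := hq
    obtain ⟨h, hh1, hh2⟩ := hr
    refine ⟨g + h, ?_, ?_⟩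
    · filter_upwards [hg1, hh1, fiber_add (g : L2Phase n) h] with p e1 e2 e3
      rw [Submodule.coe_add, e3, e1, e2, ContinuousMap.add_apply, add_smul]
    · rw [map_add]
      filter_upwards [hg2, hh2, fiber_add (U g) (U h)] with p e1 e2 e3
      rw [e3, e1, e2, ContinuousMap.add_apply, add_smul]
  | smul a q _ hq =>
    obtain ⟨g, hg1, hg2⟩ := hq
    refine ⟨a • g, ?_, ?_⟩
    · filter_upwards [hg1, fiber_smul a (g : L2Phase n)] with p e1 e3
      rw [Submodule.coe_smul, e3, e1, ContinuousMap.smul_apply, smul_assoc]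
    · rw [map_smul]
      filter_upwards [hg2, fiber_smul a (U g)] with p e1 e3
      rw [e3, e1, ContinuousMap.smul_apply, smul_assoc]

theorem ofReal_mul_enorm_le_iff {X Y : Type*} [SeminormedAddCommGroup X]
    [SeminormedAddCommGroup Y] {c : ℝ} (hc : 0 ≤ c) (x : X) (y : Y) :
    (ENNReal.ofReal c * ‖x‖ₑ) ^ 2 ≤ ‖y‖ₑ ^ 2 ↔ c * ‖x‖ ≤ ‖y‖ := by
  rw [ENNReal.pow_le_pow_left_iff two_ne_zero, ← ofReal_norm, ← ofReal_norm,
    ← ENNReal.ofReal_mul hc, ENNReal.ofReal_le_ofReal_iff (norm_nonneg y)]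

/-- This is the localization: the global bound, applied to the elements of `V` with fibers `q · 𝒥f`,
tests the two fiber densities against every `|q|²`. -/
theorem ae_norm_fiber_le {n : ℕ} {V : Submodule ℂ (L2Phase n)}
    (hV : IsTwistedShiftInvariant V) {U : V →L[ℂ] L2Phase n} (hU : IsTwistedShiftPreserving hV U)
    {c : ℝ} (hc : 0 ≤ c) (hUc : IsBoundedBelow U c) (f : V) :
    ∀ᵐ p ∂torusSq n, c * ‖fiber (f : L2Phase n) p‖ ≤ ‖fiber (U f) p‖ := by
  have hm : AEMeasurable (fun p => ENNReal.ofReal c ^ 2 * ‖fiber (f : L2Phase n) p‖ₑ ^ 2)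
      (torusSq n) := (aemeasurable_enorm_fiber_sq _).const_mul _
  have hcT : ENNReal.ofReal c ^ 2 ≠ ⊤ := ENNReal.pow_ne_top ENNReal.ofReal_ne_top
  have h := ae_le_of_forall_trigonometric (aemeasurable_enorm_fiber_sq (U f)) hm
    (by rw [lintegral_enorm_fiber_sq]; exact ENNReal.pow_ne_top enorm_ne_top)
    (by
      rw [lintegral_const_mul' _ _ hcT, lintegral_enorm_fiber_sq]
      exact ENNReal.mul_ne_top hcT (ENNReal.pow_ne_top enorm_ne_top))
    fun q hq => by
      obtain ⟨g, hg1, hg2⟩ := exists_fiber_eq_smul hV hU f hq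
      have e1 : ∫⁻ p, ENNReal.ofReal c ^ 2 * ‖fiber (f : L2Phase n) p‖ₑ ^ 2 *
          ‖q (torusMap p)‖ₑ ^ 2 ∂torusSq n = (ENNReal.ofReal c * ‖g‖ₑ) ^ 2 := by
        have : ‖g‖ₑ = ‖(g : L2Phase n)‖ₑ := rfl
        rw [mul_pow, this, ← lintegral_enorm_fiber_sq, ← lintegral_const_mul' _ _ hcT]
        refine lintegral_congr_ae ?_
        filter_upwards [hg1] with p hp
        rw [hp, enorm_smul, mul_pow, mul_assoc, mul_comm (‖q (torusMap p)‖ₑ ^ 2)]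
      have e2 : ∫⁻ p, ‖fiber (U f) p‖ₑ ^ 2 * ‖q (torusMap p)‖ₑ ^ 2 ∂torusSq n = ‖U g‖ₑ ^ 2 := by
        rw [← lintegral_enorm_fiber_sq]
        refine lintegral_congr_ae ?_
        filter_upwards [hg2] with p hp
        rw [hp, enorm_smul, mul_pow, mul_comm]
      rw [e1, e2]
      exact (ofReal_mul_enorm_le_iff hc g (U g)).2 (hUc g)
  filter_upwards [h] with p hp
  rw [← mul_pow] at hp
  exact (ofReal_mul_enorm_le_iff hc _ _).1 hp

/-! ### From a dense family of fibers to the whole range space -/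

/-- For a fixed index set `s` both norms depend continuously on the coefficients, so a dense set of
coefficient sequences suffices, and this set may be countable. A second limit passes from the span
to its closure `W`. -/
theorem isBoundedBelow_of_dense {X Y : Type*} [NormedAddCommGroup X] [NormedSpace ℂ X]
    [NormedAddCommGroup Y] [NormedSpace ℂ Y] {W : Submodule ℂ X} (A : W →L[ℂ] Y) {c : ℝ}
    {x : ℕ → X} (hW : W = (Submodule.span ℂ (Set.range x)).topologicalClosure)
    {D : Set (ℕ → ℂ)} (hD : Dense D)
    (h : ∀ s : Finset ℕ, ∀ a ∈ D, ∃ hw : ∑ i ∈ s, a i • x i ∈ W,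
      c * ‖∑ i ∈ s, a i • x i‖ ≤ ‖A ⟨∑ i ∈ s, a i • x i, hw⟩‖) :
    IsBoundedBelow A c := by
  have hsub : Submodule.span ℂ (Set.range x) ≤ W := hW ▸ Submodule.le_topologicalClosure _
  have hmem : ∀ (s : Finset ℕ) (a : ℕ → ℂ), ∑ i ∈ s, a i • x i ∈ W := fun s a =>
    sum_mem fun i _ => W.smul_mem _ (hsub (Submodule.subset_span ⟨i, rfl⟩))
  have hall : ∀ (s : Finset ℕ) (a : ℕ → ℂ),
      c * ‖∑ i ∈ s, a i • x i‖ ≤ ‖A ⟨∑ i ∈ s, a i • x i, hmem s a⟩‖ := by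
    intro s a
    refine hD.induction (P := fun a => c * ‖∑ i ∈ s, a i • x i‖ ≤
      ‖A ⟨∑ i ∈ s, a i • x i, hmem s a⟩‖) (fun a ha => (h s a ha).2) ?_ a
    have hcont : Continuous fun a : ℕ → ℂ => ∑ i ∈ s, a i • x i := by fun_prop
    exact isClosed_le (continuous_const.mul hcont.norm)
      (A.continuous.comp (hcont.subtype_mk (hmem s))).norm
  intro w
  have hdense : Dense {w : W | (w : X) ∈ Submodule.span ℂ (Set.range x)} := by
    intro w
    rw [closure_subtype]
    refine closure_mono ?_ (show (w : X) ∈ closure (Submodule.span ℂ (Set.range x) : Set X) from ?_)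
    · exact fun y hy => ⟨⟨y, hsub hy⟩, hy, rfl⟩
    · exact hW.le w.2
  refine hdense.induction (P := fun w => c * ‖w‖ ≤ ‖A w‖) (fun w hw => ?_)
    (isClosed_le (by fun_prop) (by fun_prop)) w
  obtain ⟨a, ha⟩ := Finsupp.mem_span_range_iff_exists_finsupp.1 hw
  have ha' : w = ⟨∑ i ∈ a.support, a i • x i, hmem a.support a⟩ := Subtype.ext ha.symm
  rw [ha']
  exact hall a.support a

/-! ### The two implications. -/

theorem ae_isBoundedBelow_of_isBoundedBelow {n : ℕ} {V : Submodule ℂ (L2Phase n)}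
    (hV : IsTwistedShiftInvariant V) {J : E n × E n → ClosedSubmodule ℂ (L2Space n)}
    (hJ : IsRangeFunction V J) {U : V →L[ℂ] L2Phase n} (hU : IsTwistedShiftPreserving hV U)
    {R : ∀ p, (J p : Submodule ℂ (L2Space n)) →L[ℂ] L2Space n} (hR : IsRangeOperatorOf U R)
    {c : ℝ} (hc : 0 ≤ c) (hUc : IsBoundedBelow U c) :
    ∀ᵐ p ∂torusSq n, IsBoundedBelow (R p) c := by
  obtain ⟨f, -, hf⟩ := hJ
  -- The product space `ℕ → ℂ` is separable, so the pairs `(s, j)` index only countably many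
  -- combinations and one null set serves them all.
  set d : ℕ → ℕ → ℂ := TopologicalSpace.denseSeq (ℕ → ℂ) with hd
  set g : Finset ℕ → ℕ → V := fun s j => ∑ i ∈ s, d j i • f i with hg
  have h1 : ∀ᵐ p ∂torusSq n, ∀ s j, fiber (g s j : L2Phase n) p =
      ∑ i ∈ s, d j i • fiber (f i : L2Phase n) p := by
    refine ae_all_iff.2 fun s => ae_all_iff.2 fun j => ?_
    filter_upwards [fiber_sum_smul s (d j) fun i => (f i : L2Phase n)] with p hp
    rw [← hp]
    simp [hg]
  have h2 : ∀ᵐ p ∂torusSq n, ∀ s j, c * ‖fiber (g s j : L2Phase n) p‖ ≤ ‖fiber (U (g s j)) p‖ :=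
    ae_all_iff.2 fun s => ae_all_iff.2 fun j => ae_norm_fiber_le hV hU hc hUc _
  have h3 : ∀ᵐ p ∂torusSq n, ∀ s j,
      ∃ h : fiber (g s j : L2Phase n) p ∈ (J p : Submodule ℂ (L2Space n)),
        fiber (U (g s j)) p = R p ⟨fiber (g s j : L2Phase n) p, h⟩ :=
    ae_all_iff.2 fun s => ae_all_iff.2 fun j => hR.fiber_eq _
  filter_upwards [h1, h2, h3, hf] with p e1 e2 e3 e4
  refine isBoundedBelow_of_dense (R p) e4 (TopologicalSpace.denseRange_denseSeq (ℕ → ℂ)) ?_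
  rintro s _ ⟨j, rfl⟩
  obtain ⟨hw, hw'⟩ := e3 s j
  have h := e2 s j
  rw [hw'] at h
  simp only [e1] at h
  exact ⟨e1 s j ▸ hw, h⟩

theorem isBoundedBelow_of_ae_isBoundedBelow {n : ℕ} {V : Submodule ℂ (L2Phase n)}
    {J : E n × E n → ClosedSubmodule ℂ (L2Space n)} {U : V →L[ℂ] L2Phase n}
    {R : ∀ p, (J p : Submodule ℂ (L2Space n)) →L[ℂ] L2Space n} (hR : IsRangeOperatorOf U R)
    {c : ℝ} (hc : 0 ≤ c) (h : ∀ᵐ p ∂torusSq n, IsBoundedBelow (R p) c) :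
    IsBoundedBelow U c := by
  intro f
  have hcT : ENNReal.ofReal c ^ 2 ≠ ⊤ := ENNReal.pow_ne_top ENNReal.ofReal_ne_top
  refine (ofReal_mul_enorm_le_iff hc (f : L2Phase n) (U f)).1 ?_
  -- Both squared norms become integrals over fibers, where the pointwise bound for `R p` applies.
  rw [mul_pow, ← lintegral_enorm_fiber_sq, ← lintegral_enorm_fiber_sq,
    ← lintegral_const_mul' _ _ hcT]
  refine lintegral_mono_ae ?_
  filter_upwards [h, hR.fiber_eq f] with p h1 h2
  obtain ⟨hp, hp'⟩ := h2
  rw [← mul_pow, ofReal_mul_enorm_le_iff hc, hp']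
  exact h1 ⟨_, hp⟩

end TwistedShift

end

theorem mainTheorem4 (n : ℕ) (V : Submodule ℂ (TwistedShift.L2Phase n))
    (hV : TwistedShift.IsTwistedShiftInvariant V)
    (J : TwistedShift.E n × TwistedShift.E n → ClosedSubmodule ℂ (TwistedShift.L2Space n))
    (hJ : TwistedShift.IsRangeFunction V J)
    (U : V →L[ℂ] TwistedShift.L2Phase n) (hU : TwistedShift.IsTwistedShiftPreserving hV U)
    (R : ∀ p, (J p : Submodule ℂ (TwistedShift.L2Space n)) →L[ℂ] TwistedShift.L2Space n)
    (hR : TwistedShift.IsRangeOperatorOf U R) (c : ℝ) (hc : 0 < c) :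
    TwistedShift.IsBoundedBelow U c ↔
      ∀ᵐ p ∂TwistedShift.torusSq n, TwistedShift.IsBoundedBelow (R p) c := by
  exact ⟨TwistedShift.ae_isBoundedBelow_of_isBoundedBelow hV hJ hU hR hc.le,
    TwistedShift.isBoundedBelow_of_ae_isBoundedBelow hR hc.le⟩
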